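/- Let $\delta=1+\sqrt2$ and let $\Gamma$ be the simple bipartite graph with vertices $0,\dots,7$ and edges $07,74,76,43,45,65,61,52$, with even vertices $0,2,4,6$. It has the Frobenius–Perron eigenvector $\mu$ of eigenvalue $\delta$ with $\mu_0=\mu_1=\mu_2=\mu_3=1$ and $\mu_4=\mu_5=\mu_6=\mu_7=\delta$. Let $\mathcal G_\bullet$ be the bipartite graph planar algebra of $\Gamma$: $\mathcal G_{n,+}$ (resp. $\mathcal G_{n,-}$) is spanned by the loops of length $2n$ based at even (resp. odd) vertices, boxes are multiplied by stacking, and local extrema of strings carry the spin factors $\sqrt{\mu_{\rm convex\ side}/\mu_{\rm other\ side}}$. Write $wxyz$ for the loop in $\mathcal G_{2,\pm}$ which passes the regions left, top, right, bottom of the box. Let $\mathcal F:\mathcal G_{2,\pm}\to\mathcal G_{2,\mp}$ be the one-click rotation (the bottom left string is bent up around the left, the top right string is bent down around the right), let $E\in\mathcal G_{2,\pm}$ be the Temperley–Lieb diagram $\cup$ over $\cap$, and put $e_1=\delta^{-1}E$, $f^{(2)}=\mathbf 1-e_1$, $TL_{2,+}=\operatorname{span}\{\mathbf 1_{2,+},E\}$.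 For $\lambda\in\mathbb C$ with $|\lambda|=1$ let $A=A(\lambda)\in\mathcal G_{2,+}$ be the element whose nonzero loop coefficients are: * $1$ at $0767,6707,2545,4525$ and $-1$ at $0747,4707,2565,6525$; * $\lambda$ at $6745,4567$ and $\overline\lambda$ at $6547,4765$; * $\delta^{-1}$ at $6565,4747$ and $-\delta^{-1}$ at $6767,4545$; * $\delta^{-1/2}$ at $6761,6167,4543,4345$ and $-\delta^{-1/2}$ at $6561,6165,4743,4347$. Consider the following properties (P) of an element $A\in\mathcal G_{2,+}$: $A^*=A$, $\mathcal F^2(A)=A$, $A$ is uncappable (joining any two adjacent boundary points gives $0$), $A^2=f^{(2)}$ and $\mathcal F(A)^2=f^{(2)}$. An element $R\in\mathcal G_{2,+}$ is a *quadratic $\sigma$-braiding* with constant $a\in\mathbb C\setminus\{0\}$ if 1. $R$ is invertible for stacking, and the horizontal product of $R$ with $\mathcal F^2(R^{-1})$ (side by side, joined by two strings) is $E$; 2. joining the top right to the bottom right boundary point of $R$ gives $a\,\mathbf 1_{1,+}$, and of $\mathcal F(R)$ gives $\sigma a^{-1}\,\mathbf 1_{1,-}$; 3. $R-\sigma^2\mathcal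 F^2(R)\in TL_{2,+}$; 4. in $\mathcal G_{3,+}$, with $R_1$ the box $R$ on strings $1,2$ and $S_2$ the box $\mathcal F(R^{-1})$ on strings $2,3$: $\ \sigma\,R_1S_2R_1=\sigma^2\,S_2R_1S_2$; 5. $R^2\in TL_{2,+}\oplus\mathbb C R$ (the sum being direct). It is a quadratic $\sigma$-braiding if this holds for some $a\ne0$. **Proposition.** For every $\lambda\in\mathbb C$ with $|\lambda|=1$, the element $A(\lambda)$ satisfies (P), and $$R=R(\lambda)=\tfrac{\sqrt2}{2}\,i\,\bigl(\mathbf 1_{2,+}-(1+\sqrt2)e_1\bigr)+\tfrac{\sqrt2}{2}A(\lambda)$$ is a quadratic $(+1)$-braiding. Independently of $\lambda$, its constant is $a=i$ (and no other $a$ is possible), $\mathcal F^2(R)=R$, and $$R-R^{-1}=i\sqrt2\,\mathbf 1_{2,+}-i(2+\sqrt2)\,e_1 .$$ -/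

import Mathlib

open scoped Matrix ComplexConjugate

/-- A finite simple bipartite graph with a positive Frobenius-Perron eigenvector `weight` of
eigenvalue `modulus`. `even v = true` for the even vertices (which label unshaded regions) and
`even v = false` for the odd ones (which label shaded regions). -/
structure BipartiteGraph (V : Type) [Fintype V] where
  graph : SimpleGraph V
  decAdj : DecidableRel graph.Adj
  even : V → Bool
  bipartite : ∀ v w, graph.Adj v w → even v ≠ even w
  weight : V → ℝ
  weight_pos : ∀ v, 0 < weight v
  modulus : ℝ
  eigenvector : ∀ v, ∑ w with graph.Adj v w, weight w = modulus * weight v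

attribute [instance] BipartiteGraph.decAdj

namespace GraphPlanar

section General

variable {V : Type} [Fintype V] [DecidableEq V] (Γ : BipartiteGraph V)

/-- Paths of length `n` on `Γ` starting at an even (`s = true`) or odd (`s = false`) vertex. -/
def Path (s : Bool) (n : ℕ) : Type :=
  {p : Fin (n + 1) → V // Γ.even (p 0) = s ∧ ∀ i : Fin n, Γ.graph.Adj (p i.castSucc) (p i.succ)}

instance (s : Bool) (n : ℕ) : Fintype (Path Γ s n) :=
  inferInstanceAs (Fintype {p : Fin (n + 1) → V //
    Γ.even (p 0) = s ∧ ∀ i : Fin n, Γ.graph.Adj (p i.castSucc) (p i.succ)})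

instance (s : Bool) (n : ℕ) : DecidableEq (Path Γ s n) :=
  inferInstanceAs (DecidableEq {p : Fin (n + 1) → V //
    Γ.even (p 0) = s ∧ ∀ i : Fin n, Γ.graph.Adj (p i.castSucc) (p i.succ)})

variable {Γ}

/-- The path without its last step. -/
def Path.init {s : Bool} {n : ℕ} (p : Path Γ s (n + 1)) : Path Γ s n :=
  ⟨fun i => p.1 i.castSucc, p.2.1, fun i => p.2.2 i.castSucc⟩

/-- The path without its first step; its first vertex has the opposite parity. -/
def Path.tail {s t : Bool} (h : t = !s) {n : ℕ} (p : Path Γ t (n + 1)) : Path Γ s n :=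
  ⟨fun i => p.1 i.succ, by
    have h0 := Γ.bipartite _ _ (p.2.2 0)
    have h1 := p.2.1
    simp only [Fin.castSucc_zero] at h0
    rw [h1] at h0
    subst h
    simpa using h0.symm, fun i => p.2.2 i.succ⟩

variable (Γ)

/-- The box space `𝒢_{n,+}` (`s = true`) or `𝒢_{n,-}` (`s = false`) of the graph planar algebra.
A loop of length `2n` based at a vertex of parity `s` is a pair `(p, q)` of paths of length `n` with
common first and common last vertex: reading clockwise from the `⋆` on the left, the loop runs
along `p` (across the top strings) and back along `q` (across the bottom strings). A linear
combination of such loops is stored as the matrix of its coefficients, and stacking of boxes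
(top box on the left) is matrix multiplication. -/
def box (s : Bool) (n : ℕ) : Submodule ℂ (Matrix (Path Γ s n) (Path Γ s n) ℂ) where
  carrier := {X | ∀ p q, ¬ (p.1 0 = q.1 0 ∧ p.1 (Fin.last n) = q.1 (Fin.last n)) → X p q = 0}
  zero_mem' := fun _ _ _ => rfl
  add_mem' := fun hX hY p q h => by simp [hX p q h, hY p q h]
  smul_mem' := fun c X hX p q h => by simp [hX p q h]

/-! Rectangular diagrams with `m` strings at the bottom and `n` strings at the top, whose leftmost
region has parity `s`, are `Matrix (Path Γ s n) (Path Γ s m) ℂ`. Diagrams are composed from bottom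
to top (right factor at the bottom). The local extrema carry the usual factors
`√(weight of the convex side / weight of the other side)`. -/

/-- The diagram `∪`, from no strings to two strings. -/
noncomputable def cup (s : Bool) : Matrix (Path Γ s 2) (Path Γ s 0) ℂ := fun p q =>
  if p.1 0 = q.1 0 ∧ p.1 2 = q.1 0 then (Real.sqrt (Γ.weight (p.1 1) / Γ.weight (p.1 0)) : ℂ) else 0

/-- The diagram `∩`, from two strings to no strings. -/
noncomputable def cap (s : Bool) : Matrix (Path Γ s 0) (Path Γ s 2) ℂ := (cup Γ s)ᵀ

variable {Γ}

/-- Add a vertical string on the right of a diagram. -/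
def addRight {s : Bool} {m n : ℕ} (X : Matrix (Path Γ s n) (Path Γ s m) ℂ) :
    Matrix (Path Γ s (n + 1)) (Path Γ s (m + 1)) ℂ := fun p q =>
  if p.1 (Fin.last (n + 1)) = q.1 (Fin.last (m + 1)) then X p.init q.init else 0

/-- Add a vertical string on the left of a diagram; this exchanges the shading. -/
def addLeft {s t : Bool} (h : t = !s) {m n : ℕ} (X : Matrix (Path Γ s n) (Path Γ s m) ℂ) :
    Matrix (Path Γ t (n + 1)) (Path Γ t (m + 1)) ℂ := fun p q =>
  if p.1 0 = q.1 0 then X (p.tail h) (q.tail h) else 0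

/-- The one-click rotation `ℱ : 𝒢_{2,s} → 𝒢_{2,t}`, `t` the opposite of `s`: the bottom left string
is bent up around the left of the box, the top right string is bent down around its right. -/
noncomputable def rotate {s t : Bool} (h : t = !s) (X : Matrix (Path Γ s 2) (Path Γ s 2) ℂ) :
    Matrix (Path Γ t 2) (Path Γ t 2) ℂ :=
  have h' : s = !t := by simp [h]
  (addLeft h (addLeft h' (cap Γ t)) : Matrix (Path Γ t 2) (Path Γ t 4) ℂ) *
    (addLeft h (addRight X) : Matrix (Path Γ t 4) (Path Γ t 4) ℂ) *
    (addRight (addRight (cup Γ t)) : Matrix (Path Γ t 4) (Path Γ t 2) ℂ)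

/-- `ℱ² : 𝒢_{2,+} → 𝒢_{2,+}`. -/
noncomputable def rotateTwice (X : Matrix (Path Γ true 2) (Path Γ true 2) ℂ) :
    Matrix (Path Γ true 2) (Path Γ true 2) ℂ :=
  rotate (s := false) (t := true) rfl (rotate (s := true) (t := false) rfl X)

/-- Join the top right string of a 2-box to its bottom right string. -/
noncomputable def capRight {s t : Bool} (h : s = !t) (X : Matrix (Path Γ s 2) (Path Γ s 2) ℂ) :
    Matrix (Path Γ s 1) (Path Γ s 1) ℂ :=
  (addLeft h (cap Γ t) : Matrix (Path Γ s 1) (Path Γ s 3) ℂ) *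
    (addRight X : Matrix (Path Γ s 3) (Path Γ s 3) ℂ) *
    (addLeft h (cup Γ t) : Matrix (Path Γ s 3) (Path Γ s 1) ℂ)

/-- Join the top left string of a 2-box to its bottom left string. -/
noncomputable def capLeft {s t : Bool} (h : t = !s) (X : Matrix (Path Γ s 2) (Path Γ s 2) ℂ) :
    Matrix (Path Γ t 1) (Path Γ t 1) ℂ :=
  (addRight (cap Γ t) : Matrix (Path Γ t 1) (Path Γ t 3) ℂ) *
    (addLeft h X : Matrix (Path Γ t 3) (Path Γ t 3) ℂ) *
    (addRight (cup Γ t) : Matrix (Path Γ t 3) (Path Γ t 1) ℂ)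

/-- The horizontal product of two elements of `𝒢_{2,+}`: `X` and `Y` side by side, the right strings
of `X` joined to the left strings of `Y`. -/
noncomputable def horizontalMul (X Y : Matrix (Path Γ true 2) (Path Γ true 2) ℂ) :
    Matrix (Path Γ true 2) (Path Γ true 2) ℂ :=
  (addLeft (s := false) (t := true) rfl (addRight (cap Γ false)) : Matrix (Path Γ true 2) (Path Γ true 4) ℂ) *
    (addRight (addRight X) : Matrix (Path Γ true 4) (Path Γ true 4) ℂ) *
    (addLeft (s := false) (t := true) rfl (addLeft (s := true) rfl Y) :
      Matrix (Path Γ true 4) (Path Γ true 4) ℂ) *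
    (addLeft (s := false) (t := true) rfl (addRight (cup Γ false)) : Matrix (Path Γ true 4) (Path Γ true 2) ℂ)

variable (Γ)

/-- The Temperley-Lieb diagram `∪` over `∩` in `𝒢_{2,s}`. -/
noncomputable def cupcap (s : Bool) : Matrix (Path Γ s 2) (Path Γ s 2) ℂ := cup Γ s * cap Γ s

/-- The Jones projection in `𝒢_{2,s}`. -/
noncomputable def jones (s : Bool) : Matrix (Path Γ s 2) (Path Γ s 2) ℂ :=
  (Γ.modulus : ℂ)⁻¹ • cupcap Γ s

/-- The second Jones-Wenzl idempotent in `𝒢_{2,s}`. -/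
noncomputable def jonesWenzl (s : Bool) : Matrix (Path Γ s 2) (Path Γ s 2) ℂ := 1 - jones Γ s

/-- The Temperley-Lieb space `TL_{2,+}`, the span of the two planar diagrams without boxes. -/
noncomputable def temperleyLieb : Submodule ℂ (Matrix (Path Γ true 2) (Path Γ true 2) ℂ) :=
  Submodule.span ℂ {1, cupcap Γ true}

variable {Γ}

/-- Joining any two adjacent boundary points of `X` gives zero. -/
structure Uncappable (X : Matrix (Path Γ true 2) (Path Γ true 2) ℂ) : Prop where
  top : cap Γ true * X = 0
  bottom : X * cup Γ true = 0
  right : capRight (t := false) rfl X = 0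
  left : capLeft (t := false) rfl X = 0

/-- `R ∈ 𝒢_{2,+}` is a quadratic `σ`-braiding with capping constant `a`. -/
structure IsQuadraticBraidingWith (σ a : ℂ)
    (R : Matrix (Path Γ true 2) (Path Γ true 2) ℂ) : Prop where
  mem_box : R ∈ box Γ true 2
  ne_zero : a ≠ 0
  /-- `R⁻¹` is an honest two-sided inverse for stacking -/
  inv_mul : R⁻¹ * R = 1
  mul_inv : R * R⁻¹ = 1
  /-- `R` next to `R⁻¹`, the `⋆` of `R⁻¹` being on its right -/
  horizontal_inv : horizontalMul R (rotateTwice R⁻¹) = cupcap Γ true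
  /-- capping on the right with the `⋆` of `R` on the left -/
  cap_left_star : capRight (t := false) rfl R = a • 1
  /-- capping on the right with the `⋆` of `R` on the top -/
  cap_top_star :
    capRight (s := false) (t := true) rfl (rotate (s := true) rfl R) = (σ * a⁻¹) • 1
  rotate_sub_mem : R - σ ^ 2 • rotateTwice R ∈ temperleyLieb Γ
  /-- the `σ`-braid relation in `𝒢_{3,+}`: on the second and third string the boxes have their `⋆`
  on the top -/
  braid : σ • (addRight R *
      addLeft (s := false) (t := true) rfl (rotate (s := true) rfl R⁻¹) * addRight R) =
    σ ^ 2 • (addLeft (s := false) (t := true) rfl (rotate (s := true) rfl R⁻¹) * addRight R *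
      addLeft (s := false) (t := true) rfl (rotate (s := true) rfl R⁻¹))
  /-- `R²` lies in the direct sum of `TL_{2,+}` and `ℂ R` -/
  quadratic : R * R ∈ temperleyLieb Γ ⊔ Submodule.span ℂ {R}
  disjoint : Disjoint (temperleyLieb Γ) (Submodule.span ℂ {R})

/-- `R ∈ 𝒢_{2,+}` is a quadratic `σ`-braiding. -/
def IsQuadraticBraiding (σ : ℂ) (R : Matrix (Path Γ true 2) (Path Γ true 2) ℂ) : Prop :=
  ∃ a : ℂ, IsQuadraticBraidingWith σ a R

end General

/-- The graph with the pendant edges `0-7`, `3-4`, `2-5`, `1-6` on the square `7-4-5-6`. The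
eigenvector is normalized to be `1` at the vertex `0`. -/
noncomputable def shuriken : BipartiteGraph (Fin 8) where
  graph := SimpleGraph.fromRel fun v w => (v, w) ∈
    ([(0, 7), (7, 4), (7, 6), (4, 3), (4, 5), (6, 5), (6, 1), (5, 2)] : List (Fin 8 × Fin 8))
  decAdj := inferInstance
  even := fun v => decide (v ∈ ([0, 2, 4, 6] : List (Fin 8)))
  bipartite := by
    intro v w
    revert v w
    decide
  weight := fun v => if v < 4 then 1 else 1 + Real.sqrt 2
  weight_pos := by
    intro v
    split_ifs <;> positivity
  modulus := 1 + Real.sqrt 2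
  eigenvector := by
    intro v
    have h2 : Real.sqrt 2 * Real.sqrt 2 = 2 := Real.mul_self_sqrt (by norm_num)
    rw [Finset.sum_filter]
    fin_cases v <;> simp [Fin.sum_univ_eight, SimpleGraph.fromRel_adj] <;> nlinarith [h2]

/-- The coefficient in `A(lam)` of the loop `w x y z` on `shuriken`, with `δ = 1 + √2`. -/
noncomputable def coeffA (lam : ℂ) : Fin 8 → Fin 8 → Fin 8 → Fin 8 → ℂ
  | 0, 7, 6, 7 => 1
  | 0, 7, 4, 7 => -1
  | 6, 7, 0, 7 => 1
  | 4, 7, 0, 7 => -1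
  | 2, 5, 6, 5 => -1
  | 2, 5, 4, 5 => 1
  | 6, 5, 2, 5 => -1
  | 4, 5, 2, 5 => 1
  | 6, 7, 4, 5 => lam
  | 6, 5, 4, 7 => conj lam
  | 4, 7, 6, 5 => conj lam
  | 4, 5, 6, 7 => lam
  | 6, 7, 6, 7 => -(1 + Real.sqrt 2 : ℂ)⁻¹
  | 6, 5, 6, 5 => (1 + Real.sqrt 2 : ℂ)⁻¹
  | 4, 7, 4, 7 => (1 + Real.sqrt 2 : ℂ)⁻¹
  | 4, 5, 4, 5 => -(1 + Real.sqrt 2 : ℂ)⁻¹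
  | 6, 7, 6, 1 => (Real.sqrt (1 + Real.sqrt 2) : ℂ)⁻¹
  | 6, 1, 6, 7 => (Real.sqrt (1 + Real.sqrt 2) : ℂ)⁻¹
  | 6, 5, 6, 1 => -(Real.sqrt (1 + Real.sqrt 2) : ℂ)⁻¹
  | 6, 1, 6, 5 => -(Real.sqrt (1 + Real.sqrt 2) : ℂ)⁻¹
  | 4, 7, 4, 3 => -(Real.sqrt (1 + Real.sqrt 2) : ℂ)⁻¹
  | 4, 3, 4, 7 => -(Real.sqrt (1 + Real.sqrt 2) : ℂ)⁻¹
  | 4, 5, 4, 3 => (Real.sqrt (1 + Real.sqrt 2) : ℂ)⁻¹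
  | 4, 3, 4, 5 => (Real.sqrt (1 + Real.sqrt 2) : ℂ)⁻¹
  | _, _, _, _ => 0

/-- The element `A(lam)` of `𝒢_{2,+}`. -/
noncomputable def elementA (lam : ℂ) :
    Matrix (Path shuriken true 2) (Path shuriken true 2) ℂ := fun p q =>
  if p.1 0 = q.1 0 ∧ p.1 2 = q.1 2 then coeffA lam (p.1 0) (p.1 1) (p.1 2) (q.1 1) else 0

/-- The element `R(lam)` of `𝒢_{2,+}`. -/
noncomputable def elementR (lam : ℂ) : Matrix (Path shuriken true 2) (Path shuriken true 2) ℂ :=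
  (Real.sqrt 2 / 2 * Complex.I : ℂ) • (1 - (1 + Real.sqrt 2 : ℂ) • jones shuriken true) +
    (Real.sqrt 2 / 2 : ℂ) • elementA lam

end GraphPlanar

/-! An element of `𝒢_{2,±}` is a function of four vertices, the coefficients of the loops `w x y z`,
and every planar operation in the statement becomes a local formula for such functions: stacking is
a sum over the vertex between the two boxes (`ofCoeff_mul`), the one-click rotation permutes the
arguments and multiplies by spin factors (`rotate_ofCoeff`), caps are weighted sums over a neighbour
(`capRight_ofCoeff`, `capLeft_ofCoeff`), and both sides of the braid relation are sums over the
vertex inside a hexagon (`addRight_mul_addLeft_mul_addRight`, `addLeft_mul_addRight_mul_addLeft`).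

With `e = δ⁻¹ E` and `δ = 1 + √2` one has `√2 R = i (1 - E) + A`. The rotation exchanges `1` and
`E`, so `√2 ℱ(R⁻¹) = i (1 - E) + ℱ(A)` has the same shape. Everything except the braid relation
follows formally from `A² = 1 - e`, `ℱ(A)² = 1 - e`, `ℱ²(A) = A` and the vanishing of all caps of
`A`. In particular `(i (1 - E) + A) (-i (1 - E) + A) = 2` because `δ² = 2 δ + 1`
(`mul_eq_one_of_sq`), which gives the inverse of `R`. The same identity for `ℱ(A)` gives the
horizontal inverse, since `ℱ` turns the horizontal product into stacking
(`horizontalMul_rotateTwice`).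

What depends on the graph is then a finite set of identities between coefficients in
`ℤ[√2, δ^{-1/2}, i, λ, λ⁻¹]`. The permutation `2k ↔ 2k + 1` of the vertices is an automorphism of
the graph that exchanges the parities and carries `A(λ̄)` to `ℱ(A(λ))` (`rotate_elementA`), so
one table of coefficients serves both shadings. The braid relation is checked hexagon by hexagon
(`hexagon_relation`). Finally, `R` is not in the Temperley-Lieb space because its coefficients at
`0767` and `0747` differ. -/

namespace GraphPlanar

section General

variable {V : Type} [Fintype V] {Γ : BipartiteGraph V}

/-! ### Coefficient functions and sums over paths -/

/-- A sum over paths is a sum over all tuples of vertices in which the entries of the adjacency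
matrix select the paths. -/
theorem sum_path {s : Bool} {n : ℕ} (f : (Fin (n + 1) → V) → ℂ) :
    ∑ r : Path Γ s n, f r.1 = ∑ g : Fin (n + 1) → V, (if Γ.even (g 0) = s then (1 : ℂ) else 0) *
      ((∏ i : Fin n, Γ.graph.adjMatrix ℂ (g i.castSucc) (g i.succ)) * f g) := by
  classical
  have h : ∀ g : Fin (n + 1) → V, (if Γ.even (g 0) = s then (1 : ℂ) else 0) *
      ((∏ i : Fin n, Γ.graph.adjMatrix ℂ (g i.castSucc) (g i.succ)) * f g) =
      if Γ.even (g 0) = s ∧ ∀ i : Fin n, Γ.graph.Adj (g i.castSucc) (g i.succ) then f g else 0 := by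
    intro g
    simp only [SimpleGraph.adjMatrix_apply, Finset.prod_ite_zero, ite_and]
    split_ifs <;> simp_all
  simp only [h]
  rw [← Finset.sum_filter]
  exact (Finset.sum_subtype _ (by simp) f).symm

theorem sum_fin_succ {n : ℕ} (f : (Fin (n + 1) → V) → ℂ) :
    ∑ g : Fin (n + 1) → V, f g = ∑ a : V, ∑ g : Fin n → V, f (Matrix.vecCons a g) := by
  rw [← (Fin.consEquiv fun _ : Fin (n + 1) => V).sum_comp, Fintype.sum_prod_type]
  rfl

theorem sum_path_two {s : Bool} (f : V → V → V → ℂ) :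
    ∑ r : Path Γ s 2, f (r.1 0) (r.1 1) (r.1 2) = ∑ a, ∑ b, ∑ c,
      (if Γ.even a = s then (1 : ℂ) else 0) * (Γ.graph.adjMatrix ℂ a b *
        Γ.graph.adjMatrix ℂ b c * f a b c) := by
  rw [sum_path (fun g => f (g 0) (g 1) (g 2))]
  simp [sum_fin_succ, -SimpleGraph.adjMatrix_apply, Fin.prod_univ_succ]

theorem sum_path_three {s : Bool} (f : V → V → V → V → ℂ) :
    ∑ r : Path Γ s 3, f (r.1 0) (r.1 1) (r.1 2) (r.1 3) = ∑ a, ∑ b, ∑ c, ∑ d,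
      (if Γ.even a = s then (1 : ℂ) else 0) * (Γ.graph.adjMatrix ℂ a b *
        (Γ.graph.adjMatrix ℂ b c * Γ.graph.adjMatrix ℂ c d) * f a b c d) := by
  rw [sum_path (fun g => f (g 0) (g 1) (g 2) (g 3))]
  simp [sum_fin_succ, -SimpleGraph.adjMatrix_apply, Fin.prod_univ_succ]

theorem sum_path_four {s : Bool} (f : V → V → V → V → V → ℂ) :
    ∑ r : Path Γ s 4, f (r.1 0) (r.1 1) (r.1 2) (r.1 3) (r.1 4) = ∑ a, ∑ b, ∑ c, ∑ d, ∑ e,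
      (if Γ.even a = s then (1 : ℂ) else 0) * (Γ.graph.adjMatrix ℂ a b *
        (Γ.graph.adjMatrix ℂ b c * (Γ.graph.adjMatrix ℂ c d * Γ.graph.adjMatrix ℂ d e)) *
          f a b c d e) := by
  rw [sum_path (fun g => f (g 0) (g 1) (g 2) (g 3) (g 4))]
  simp [sum_fin_succ, -SimpleGraph.adjMatrix_apply, Fin.prod_univ_succ]

theorem adj_one {s : Bool} {n : ℕ} (p : Path Γ s n) (i : Fin n) :
    Γ.graph.adjMatrix ℂ (p.1 i.castSucc) (p.1 i.succ) = 1 := by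
  simp [p.2.2 i]

theorem adj_comm (Γ : BipartiteGraph V) (v w : V) :
    Γ.graph.adjMatrix ℂ v w = Γ.graph.adjMatrix ℂ w v := by
  simp [SimpleGraph.adj_comm]

theorem path_one_ext {s : Bool} {p q : Path Γ s 1} (h0 : p.1 0 = q.1 0) (h1 : p.1 1 = q.1 1) :
    p = q := by
  refine Subtype.ext (funext fun i => ?_)
  fin_cases i
  exacts [h0, h1]

theorem sqrt_mul_sqrt_weight (v w : V) :
    (√(Γ.weight v / Γ.weight w) : ℂ) * √(Γ.weight v / Γ.weight w) = Γ.weight v / Γ.weight w := by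
  rw [← Complex.ofReal_mul, Real.mul_self_sqrt (div_pos (Γ.weight_pos v) (Γ.weight_pos w)).le]
  simp

theorem sqrt_div_mul_sqrt_div (v w : V) :
    (√(Γ.weight v / Γ.weight w) : ℂ) * √(Γ.weight w / Γ.weight v) = 1 := by
  rw [← Complex.ofReal_mul, ← Real.sqrt_mul (div_pos (Γ.weight_pos v) (Γ.weight_pos w)).le]
  have := (Γ.weight_pos v).ne'
  have := (Γ.weight_pos w).ne'
  rw [show Γ.weight v / Γ.weight w * (Γ.weight w / Γ.weight v) = 1 by field_simp]
  simp

theorem sqrt_div_mul_sqrt_div_trans (u v w : V) :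
    (√(Γ.weight u / Γ.weight v) : ℂ) * √(Γ.weight v / Γ.weight w) =
      √(Γ.weight u / Γ.weight w) := by
  rw [← Complex.ofReal_mul, ← Real.sqrt_mul (div_pos (Γ.weight_pos u) (Γ.weight_pos v)).le]
  have := (Γ.weight_pos v).ne'
  have := (Γ.weight_pos w).ne'
  rw [show Γ.weight u / Γ.weight v * (Γ.weight v / Γ.weight w) = Γ.weight u / Γ.weight w by
    field_simp]

/-- The eigenvector equation: a closed loop contributes the modulus. -/
theorem sum_adj_weight (w : V) :
    ∑ v, Γ.graph.adjMatrix ℂ w v * (Γ.weight v / Γ.weight w : ℂ) = Γ.modulus := by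
  have hw : (Γ.weight w : ℂ) ≠ 0 := by exact_mod_cast (Γ.weight_pos _).ne'
  rw [eq_comm, ← mul_div_cancel_right₀ (Γ.modulus : ℂ) hw, ← Complex.ofReal_mul,
    ← Γ.eigenvector w, Finset.sum_filter, Complex.ofReal_sum, Finset.sum_div]
  refine Finset.sum_congr rfl fun v _ => ?_
  rw [SimpleGraph.adjMatrix_apply]
  split_ifs <;> simp

variable [DecidableEq V]

variable (Γ) in
/-- The element of the box space of 2-boxes in which the loop `w x y z` (left, top, right, bottom)
has coefficient `c w x y z`. The values of `c` on tuples that are not loops play no role. -/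
def ofCoeff (s : Bool) (c : V → V → V → V → ℂ) : Matrix (Path Γ s 2) (Path Γ s 2) ℂ := fun p q =>
  if p.1 0 = q.1 0 ∧ p.1 2 = q.1 2 then c (p.1 0) (p.1 1) (p.1 2) (q.1 1) else 0

theorem cup_apply {s : Bool} (p : Path Γ s 2) (q : Path Γ s 0) :
    cup Γ s p q = if p.1 0 = q.1 0 ∧ p.1 2 = q.1 0 then
      (√(Γ.weight (p.1 1) / Γ.weight (p.1 0)) : ℂ) else 0 := rfl

theorem cap_apply {s : Bool} (p : Path Γ s 0) (q : Path Γ s 2) :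
    cap Γ s p q = if q.1 0 = p.1 0 ∧ q.1 2 = p.1 0 then
      (√(Γ.weight (q.1 1) / Γ.weight (q.1 0)) : ℂ) else 0 := rfl

theorem ofCoeff_mul {s : Bool} (c d : V → V → V → V → ℂ) :
    ofCoeff Γ s c * ofCoeff Γ s d = ofCoeff Γ s fun w x y z =>
      ∑ v, Γ.graph.adjMatrix ℂ w v * Γ.graph.adjMatrix ℂ v y * (c w x y v * d w v y z) := by
  ext p q
  have h := p.2.1
  simp only [Matrix.mul_apply, ofCoeff]
  rw [sum_path_two (fun a b e =>
    (if p.1 0 = a ∧ p.1 2 = e then c (p.1 0) (p.1 1) (p.1 2) b else 0) *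
    (if a = q.1 0 ∧ e = q.1 2 then d a b e (q.1 1) else 0))]
  simp only [ite_and, mul_ite, ite_mul, mul_zero, zero_mul, Finset.sum_ite_irrel,
    Finset.sum_const_zero, one_mul]
  split_ifs <;> simp_all

theorem sum_path_four_ite {s : Bool} {a b c d e : V} (ha : Γ.even a = s)
    (hab : Γ.graph.adjMatrix ℂ a b = 1) (hbc : Γ.graph.adjMatrix ℂ b c = 1)
    (hcd : Γ.graph.adjMatrix ℂ c d = 1) (hde : Γ.graph.adjMatrix ℂ d e = 1) (T : ℂ) :
    ∑ r : Path Γ s 4, (if a = r.1 0 then if b = r.1 1 then if c = r.1 2 then if d = r.1 3 then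
      if e = r.1 4 then T else 0 else 0 else 0 else 0 else 0) = T := by
  rw [sum_path_four fun a' b' c' d' e' => if a = a' then if b = b' then if c = c' then
    if d = d' then if e = e' then T else 0 else 0 else 0 else 0 else 0]
  simp [Finset.sum_ite_irrel, -SimpleGraph.adjMatrix_apply, *]

theorem sum_path_three_ite {s : Bool} {a b c d : V} (ha : Γ.even a = s)
    (hab : Γ.graph.adjMatrix ℂ a b = 1) (hbc : Γ.graph.adjMatrix ℂ b c = 1)
    (hcd : Γ.graph.adjMatrix ℂ c d = 1) (T : ℂ) :
    ∑ r : Path Γ s 3, (if a = r.1 0 then if b = r.1 1 then if c = r.1 2 then if d = r.1 3 then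
      T else 0 else 0 else 0 else 0) = T := by
  rw [sum_path_three fun a' b' c' d' => if a = a' then if b = b' then if c = c' then
    if d = d' then T else 0 else 0 else 0 else 0]
  simp [Finset.sum_ite_irrel, -SimpleGraph.adjMatrix_apply, *]

/-- The one-click rotation of a 2-box: the old left region is the new top region, and the two bent
strings contribute one spin factor each. -/
theorem rotate_ofCoeff {s t : Bool} (h : t = !s) (c : V → V → V → V → ℂ) :
    rotate h (ofCoeff Γ s c) = ofCoeff Γ t fun w x y z =>
      √(Γ.weight x / Γ.weight w) * √(Γ.weight z / Γ.weight y) * c x y z w := by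
  -- the cap, the box between two strings, and the cup, on paths of length 4
  have key : rotate h (ofCoeff Γ s c) =
      (.of fun p r => if p.1 0 = r.1 0 then if p.1 1 = r.1 1 then
        if r.1 2 = p.1 2 ∧ r.1 4 = p.1 2 then (√(Γ.weight (r.1 3) / Γ.weight (r.1 2)) : ℂ)
          else 0 else 0 else 0 : Matrix (Path Γ t 2) (Path Γ t 4) ℂ) *
      (.of fun r r' => if r.1 0 = r'.1 0 then if r.1 4 = r'.1 4 then
        if r.1 1 = r'.1 1 ∧ r.1 3 = r'.1 3 then c (r.1 1) (r.1 2) (r.1 3) (r'.1 2)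
          else 0 else 0 else 0 : Matrix (Path Γ t 4) (Path Γ t 4) ℂ) *
      (.of fun r q => if r.1 4 = q.1 2 then if r.1 3 = q.1 1 then
        if r.1 0 = q.1 0 ∧ r.1 2 = q.1 0 then (√(Γ.weight (r.1 1) / Γ.weight (r.1 0)) : ℂ)
          else 0 else 0 else 0 : Matrix (Path Γ t 4) (Path Γ t 2) ℂ) := rfl
  ext p q
  have h1 : Γ.graph.adjMatrix ℂ (p.1 0) (p.1 1) = 1 := adj_one p 0
  have h2 : Γ.graph.adjMatrix ℂ (p.1 1) (p.1 2) = 1 := adj_one p 1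
  have h3 : Γ.graph.adjMatrix ℂ (q.1 0) (q.1 1) = 1 := adj_one q 0
  have h4 : Γ.graph.adjMatrix ℂ (q.1 1) (q.1 2) = 1 := adj_one q 1
  have h3' := adj_comm Γ (q.1 0) (q.1 1)
  have h4' := adj_comm Γ (q.1 1) (q.1 2)
  have h1' := adj_comm Γ (p.1 0) (p.1 1)
  have h0 := p.2.1
  rw [key]
  simp only [Matrix.mul_apply, Finset.sum_mul, Matrix.of_apply]
  set T := ofCoeff Γ t (fun w x y z =>
    √(Γ.weight x / Γ.weight w) * √(Γ.weight z / Γ.weight y) * c x y z w) p q with hT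
  -- only `y = (p₀, p₁, q₀, q₁, q₂)` and `x = (p₀, p₁, p₂, q₁, p₂)` contribute
  by_cases hpq : p.1 0 = q.1 0 ∧ p.1 2 = q.1 2
  · trans ∑ y : Path Γ t 4, ∑ x : Path Γ t 4,
      if p.1 0 = x.1 0 then if p.1 1 = x.1 1 then if p.1 2 = x.1 2 then if q.1 1 = x.1 3 then
      if p.1 2 = x.1 4 then
        if p.1 0 = y.1 0 then if p.1 1 = y.1 1 then if q.1 0 = y.1 2 then if q.1 1 = y.1 3 then
        if q.1 2 = y.1 4 then T else 0 else 0 else 0 else 0 else 0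
      else 0 else 0 else 0 else 0 else 0
    · refine Finset.sum_congr rfl fun y _ => Finset.sum_congr rfl fun x _ => ?_
      simp only [hT, ofCoeff, ite_and, mul_ite, ite_mul, mul_zero, zero_mul]
      grind
    · simp only [sum_path_four_ite h0 h1 h2 (hpq.2 ▸ h4' ▸ h4) (hpq.2 ▸ h4)]
      exact sum_path_four_ite h0 h1 (hpq.1 ▸ h1' ▸ h1) h3 h4 _
  · rw [hT, ofCoeff, if_neg hpq]
    refine Finset.sum_eq_zero fun y _ => Finset.sum_eq_zero fun x _ => ?_
    grind

/-- In the horizontal product, the region `v` between the two boxes is summed over. It is convex for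
the arcs at the top and at the bottom. -/
theorem horizontalMul_ofCoeff (c d : V → V → V → V → ℂ) :
    horizontalMul (ofCoeff Γ true c) (ofCoeff Γ true d) = ofCoeff Γ true fun w x y z =>
      ∑ v, Γ.graph.adjMatrix ℂ x v * Γ.graph.adjMatrix ℂ v z *
        (√(Γ.weight v / Γ.weight x) * √(Γ.weight v / Γ.weight z) * (c w x v z * d v x y z)) := by
  -- the four factors of the diagram, from top to bottom, on paths of length 4
  obtain ⟨L, X, Y, N, key, hL, hX, hY, hN⟩ :
      ∃ (L : Matrix (Path Γ true 2) (Path Γ true 4) ℂ)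
        (X Y : Matrix (Path Γ true 4) (Path Γ true 4) ℂ)
        (N : Matrix (Path Γ true 4) (Path Γ true 2) ℂ),
        horizontalMul (ofCoeff Γ true c) (ofCoeff Γ true d) = L * X * Y * N ∧
        (∀ p r, L p r = if p.1 0 = r.1 0 then if p.1 2 = r.1 4 then
          if r.1 1 = p.1 1 ∧ r.1 3 = p.1 1 then (√(Γ.weight (r.1 2) / Γ.weight (r.1 1)) : ℂ)
            else 0 else 0 else 0) ∧
        (∀ r r', X r r' = if r.1 4 = r'.1 4 then if r.1 3 = r'.1 3 then
          if r.1 0 = r'.1 0 ∧ r.1 2 = r'.1 2 then c (r.1 0) (r.1 1) (r.1 2) (r'.1 1)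
            else 0 else 0 else 0) ∧
        (∀ r r', Y r r' = if r.1 0 = r'.1 0 then if r.1 1 = r'.1 1 then
          if r.1 2 = r'.1 2 ∧ r.1 4 = r'.1 4 then d (r.1 2) (r.1 3) (r.1 4) (r'.1 3)
            else 0 else 0 else 0) ∧
        ∀ r q, N r q = if r.1 0 = q.1 0 then if r.1 4 = q.1 2 then
          if r.1 1 = q.1 1 ∧ r.1 3 = q.1 1 then (√(Γ.weight (r.1 2) / Γ.weight (r.1 1)) : ℂ)
            else 0 else 0 else 0 :=
    ⟨_, _, _, _, rfl, fun _ _ => rfl, fun _ _ => rfl, fun _ _ => rfl, fun _ _ => rfl⟩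
  ext p q
  have h1 : Γ.graph.adjMatrix ℂ (p.1 0) (p.1 1) = 1 := adj_one p 0
  have h2 : Γ.graph.adjMatrix ℂ (p.1 1) (p.1 2) = 1 := adj_one p 1
  have h3 : Γ.graph.adjMatrix ℂ (q.1 0) (q.1 1) = 1 := adj_one q 0
  have h4 : Γ.graph.adjMatrix ℂ (q.1 1) (q.1 2) = 1 := adj_one q 1
  have h0 := p.2.1
  rw [key]
  by_cases hpq : p.1 0 = q.1 0 ∧ p.1 2 = q.1 2
  -- only `y = (p₀, q₁, v, q₁, p₂)`, `z = (p₀, q₁, v, p₁, p₂)`, `x = (p₀, p₁, v, p₁, p₂)` contribute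
  · rw [ofCoeff, if_pos hpq, Matrix.mul_apply]
    trans ∑ y : Path Γ true 4, (fun a b v d' e => if p.1 0 = a then if q.1 1 = b then
      if q.1 1 = d' then if p.1 2 = e then
          (Γ.graph.adjMatrix ℂ (p.1 1) v * (√(Γ.weight v / Γ.weight (p.1 1)) *
        √(Γ.weight v / Γ.weight (q.1 1)) * (c (p.1 0) (p.1 1) v (q.1 1) *
          d v (p.1 1) (p.1 2) (q.1 1))) : ℂ) else 0 else 0 else 0 else 0)
      (y.1 0) (y.1 1) (y.1 2) (y.1 3) (y.1 4)
    · refine Finset.sum_congr rfl fun y _ => ?_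
      have h5 : Γ.graph.adjMatrix ℂ (y.1 1) (y.1 2) = 1 := adj_one y 1
      have h6 : Γ.graph.adjMatrix ℂ (y.1 2) (y.1 3) = 1 := adj_one y 2
      by_cases hy : p.1 0 = y.1 0 ∧ q.1 1 = y.1 1 ∧ q.1 1 = y.1 3 ∧ p.1 2 = y.1 4
      · obtain ⟨y0, y1, y3, y4⟩ := hy
        have hyN : N y q = √(Γ.weight (y.1 2) / Γ.weight (q.1 1)) := by grind
        simp only [Matrix.mul_apply, Finset.sum_mul, hyN, ← y0, ← y1, ← y3, ← y4, if_true]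
        by_cases hv : Γ.graph.adjMatrix ℂ (p.1 1) (y.1 2) = 1
        · have hv' := adj_comm Γ (p.1 1) (y.1 2) ▸ hv
          rw [hv, one_mul, ← sum_path_four_ite h0 (hpq.1 ▸ h3) (y1 ▸ h5) hv' h2 (_ * _ * _)]
          refine Finset.sum_congr rfl fun z _ => ?_
          by_cases hz : p.1 0 = z.1 0 ∧ q.1 1 = z.1 1 ∧ y.1 2 = z.1 2 ∧ p.1 1 = z.1 3 ∧
            p.1 2 = z.1 4
          · obtain ⟨z0, z1, z2, z3, z4⟩ := hz
            simp only [← z0, ← z1, ← z2, ← z3, ← z4, if_true]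
            rw [← sum_path_four_ite h0 h1 hv hv' h2 (_ * _ * _)]
            refine Finset.sum_congr rfl fun x _ => ?_
            rw [hL, hX, hY]
            grind
          · rw [Finset.sum_eq_zero]
            · grind
            · intro x _
              rw [hL, hX, hY]
              grind
        · have hv0 : Γ.graph.adjMatrix ℂ (p.1 1) (y.1 2) = 0 := by
            simpa using hv
          rw [hv0, zero_mul]
          refine Finset.sum_eq_zero fun z _ => Finset.sum_eq_zero fun x _ => ?_
          have h7 : Γ.graph.adjMatrix ℂ (z.1 2) (z.1 3) = 1 := adj_one z 2
          have h7' := adj_comm Γ (z.1 2) (z.1 3)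
          rw [hL, hX, hY]
          grind
      · rw [hN]
        grind
    · rw [sum_path_four fun a b v d' e => if p.1 0 = a then if q.1 1 = b then
        if q.1 1 = d' then if p.1 2 = e then
          (Γ.graph.adjMatrix ℂ (p.1 1) v * (√(Γ.weight v / Γ.weight (p.1 1)) *
          √(Γ.weight v / Γ.weight (q.1 1)) * (c (p.1 0) (p.1 1) v (q.1 1) *
            d v (p.1 1) (p.1 2) (q.1 1))) : ℂ) else 0 else 0 else 0 else 0]
      simp only [mul_ite, mul_zero, Finset.sum_ite_irrel, Finset.sum_const_zero,
        Finset.sum_ite_eq, Finset.mem_univ, if_true, h0, one_mul]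
      refine Finset.sum_congr rfl fun v _ => ?_
      by_cases hv : Γ.graph.adjMatrix ℂ v (q.1 1) = 1
      · have hv' := adj_comm Γ v (q.1 1) ▸ hv
        rw [hpq.1, hpq.2, h3, h4, hv, hv']
        ring
      · have hv0 : Γ.graph.adjMatrix ℂ v (q.1 1) = 0 := by simpa using hv
        rw [hv0]
        ring
  · rw [ofCoeff, if_neg hpq]
    simp only [Matrix.mul_apply, Finset.sum_mul, hL, hX, hY, hN]
    refine Finset.sum_eq_zero fun z _ => Finset.sum_eq_zero fun y _ =>
      Finset.sum_eq_zero fun x _ => ?_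
    grind

theorem capRight_ofCoeff {s t : Bool} (h : s = !t) (c : V → V → V → V → ℂ) :
    capRight h (ofCoeff Γ s c) = Matrix.diagonal fun p : Path Γ s 1 =>
      ∑ v, Γ.graph.adjMatrix ℂ (p.1 1) v *
        (Γ.weight v / Γ.weight (p.1 1) * c (p.1 0) (p.1 1) v (p.1 1)) := by
  -- the cap, the box with a string on its right, and the cup, on paths of length 3
  have key : capRight h (ofCoeff Γ s c) =
      (.of fun p r => if p.1 0 = r.1 0 then
        if r.1 1 = p.1 1 ∧ r.1 3 = p.1 1 then (√(Γ.weight (r.1 2) / Γ.weight (r.1 1)) : ℂ)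
          else 0 else 0 : Matrix (Path Γ s 1) (Path Γ s 3) ℂ) *
      (.of fun r r' => if r.1 3 = r'.1 3 then
        if r.1 0 = r'.1 0 ∧ r.1 2 = r'.1 2 then c (r.1 0) (r.1 1) (r.1 2) (r'.1 1)
          else 0 else 0 : Matrix (Path Γ s 3) (Path Γ s 3) ℂ) *
      (.of fun r q => if r.1 0 = q.1 0 then
        if r.1 1 = q.1 1 ∧ r.1 3 = q.1 1 then (√(Γ.weight (r.1 2) / Γ.weight (r.1 1)) : ℂ)
          else 0 else 0 : Matrix (Path Γ s 3) (Path Γ s 1) ℂ) := rfl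
  ext p q
  have h1 : Γ.graph.adjMatrix ℂ (p.1 0) (p.1 1) = 1 := adj_one p 0
  have h0 := p.2.1
  rw [key, Matrix.mul_apply]
  by_cases hpq : p = q
  · subst hpq
    rw [Matrix.diagonal_apply_eq]
    trans ∑ y : Path Γ s 3, (fun a b v d => if p.1 0 = a then if p.1 1 = b then if p.1 1 = d then
      (Γ.weight v / Γ.weight (p.1 1) : ℂ) * c (p.1 0) (p.1 1) v (p.1 1) else 0 else 0 else 0)
      (y.1 0) (y.1 1) (y.1 2) (y.1 3)
    · refine Finset.sum_congr rfl fun y _ => ?_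
      have h2 : Γ.graph.adjMatrix ℂ (y.1 1) (y.1 2) = 1 := adj_one y 1
      have h3 : Γ.graph.adjMatrix ℂ (y.1 2) (y.1 3) = 1 := adj_one y 2
      rw [Matrix.mul_apply]
      by_cases hy : p.1 0 = y.1 0 ∧ p.1 1 = y.1 1 ∧ p.1 1 = y.1 3
      · obtain ⟨y0, y1, y3⟩ := hy
        simp only [Matrix.of_apply, ← y0, ← y1, ← y3, and_self, if_true]
        rw [← sqrt_mul_sqrt_weight, mul_right_comm]
        congr 1
        rw [← sum_path_three_ite h0 h1 (y1 ▸ h2) (y3 ▸ h3) (_ * _)]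
        refine Finset.sum_congr rfl fun x _ => ?_
        grind
      · simp only [Matrix.of_apply]
        grind
    · rw [sum_path_three fun a b v d => if p.1 0 = a then if p.1 1 = b then if p.1 1 = d then
        (Γ.weight v / Γ.weight (p.1 1) : ℂ) * c (p.1 0) (p.1 1) v (p.1 1) else 0 else 0 else 0]
      simp only [mul_ite, mul_zero, Finset.sum_ite_irrel, Finset.sum_const_zero,
        Finset.sum_ite_eq, Finset.mem_univ, if_true, h0, h1, one_mul]
      refine Finset.sum_congr rfl fun v _ => ?_
      rw [adj_comm Γ v]
      simp +contextual
  · rw [Matrix.diagonal_apply_ne _ hpq]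
    refine Finset.sum_eq_zero fun y _ => ?_
    rw [Matrix.mul_apply, Finset.sum_mul]
    refine Finset.sum_eq_zero fun x _ => ?_
    have := mt (path_one_ext (p := p) (q := q))
    simp only [Matrix.of_apply]
    grind

theorem capLeft_ofCoeff {s t : Bool} (h : t = !s) (c : V → V → V → V → ℂ) :
    capLeft h (ofCoeff Γ s c) = Matrix.diagonal fun p : Path Γ t 1 =>
      ∑ v, Γ.graph.adjMatrix ℂ (p.1 0) v *
        (Γ.weight v / Γ.weight (p.1 0) * c v (p.1 0) (p.1 1) (p.1 0)) := by
  -- the cap, the box with a string on its left, and the cup, on paths of length 3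
  have key : capLeft h (ofCoeff Γ s c) =
      (.of fun p r => if p.1 1 = r.1 3 then
        if r.1 0 = p.1 0 ∧ r.1 2 = p.1 0 then (√(Γ.weight (r.1 1) / Γ.weight (r.1 0)) : ℂ)
          else 0 else 0 : Matrix (Path Γ t 1) (Path Γ t 3) ℂ) *
      (.of fun r r' => if r.1 0 = r'.1 0 then
        if r.1 1 = r'.1 1 ∧ r.1 3 = r'.1 3 then c (r.1 1) (r.1 2) (r.1 3) (r'.1 2)
          else 0 else 0 : Matrix (Path Γ t 3) (Path Γ t 3) ℂ) *
      (.of fun r q => if r.1 3 = q.1 1 then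
        if r.1 0 = q.1 0 ∧ r.1 2 = q.1 0 then (√(Γ.weight (r.1 1) / Γ.weight (r.1 0)) : ℂ)
          else 0 else 0 : Matrix (Path Γ t 3) (Path Γ t 1) ℂ) := rfl
  ext p q
  have h1 : Γ.graph.adjMatrix ℂ (p.1 0) (p.1 1) = 1 := adj_one p 0
  have h0 := p.2.1
  rw [key, Matrix.mul_apply]
  by_cases hpq : p = q
  · subst hpq
    rw [Matrix.diagonal_apply_eq]
    trans ∑ y : Path Γ t 3, (fun a v b d => if p.1 0 = a then if p.1 0 = b then if p.1 1 = d then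
      (Γ.weight v / Γ.weight (p.1 0) : ℂ) * c v (p.1 0) (p.1 1) (p.1 0) else 0 else 0 else 0)
      (y.1 0) (y.1 1) (y.1 2) (y.1 3)
    · refine Finset.sum_congr rfl fun y _ => ?_
      have h2 : Γ.graph.adjMatrix ℂ (y.1 0) (y.1 1) = 1 := adj_one y 0
      have h3 : Γ.graph.adjMatrix ℂ (y.1 1) (y.1 2) = 1 := adj_one y 1
      rw [Matrix.mul_apply]
      by_cases hy : p.1 0 = y.1 0 ∧ p.1 0 = y.1 2 ∧ p.1 1 = y.1 3
      · obtain ⟨y0, y2, y3⟩ := hy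
        simp only [Matrix.of_apply, ← y0, ← y2, ← y3, and_self, if_true]
        rw [← sqrt_mul_sqrt_weight, mul_right_comm]
        congr 1
        rw [← sum_path_three_ite h0 (y0 ▸ h2) (y2 ▸ h3) h1 (_ * _)]
        refine Finset.sum_congr rfl fun x _ => ?_
        grind
      · simp only [Matrix.of_apply]
        grind
    · rw [sum_path_three fun a v b d => if p.1 0 = a then if p.1 0 = b then if p.1 1 = d then
        (Γ.weight v / Γ.weight (p.1 0) : ℂ) * c v (p.1 0) (p.1 1) (p.1 0) else 0 else 0 else 0]
      simp only [mul_ite, mul_zero, Finset.sum_ite_irrel, Finset.sum_const_zero,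
        Finset.sum_ite_eq, Finset.mem_univ, if_true, h0, h1, one_mul]
      refine Finset.sum_congr rfl fun v _ => ?_
      rw [adj_comm Γ v]
      simp +contextual
  · rw [Matrix.diagonal_apply_ne _ hpq]
    refine Finset.sum_eq_zero fun y _ => ?_
    rw [Matrix.mul_apply, Finset.sum_mul]
    refine Finset.sum_eq_zero fun x _ => ?_
    have := mt (path_one_ext (p := p) (q := q))
    simp only [Matrix.of_apply]
    grind

/-! ### Planar operations on the Temperley-Lieb diagrams -/

/-- Two coefficient functions that agree on loops define the same element. The quantifiers are
ordered so that the loops can be enumerated one vertex at a time. -/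
theorem ofCoeff_congr {s : Bool} {c d : V → V → V → V → ℂ}
    (h : ∀ w, Γ.even w = s → ∀ x, Γ.graph.Adj w x → ∀ y, Γ.graph.Adj x y →
      ∀ z, Γ.graph.Adj w z → Γ.graph.Adj z y → c w x y z = d w x y z) :
    ofCoeff Γ s c = ofCoeff Γ s d := by
  ext p q
  simp only [ofCoeff]
  split_ifs with hpq
  · refine h _ p.2.1 _ (p.2.2 0) _ (p.2.2 1) _ ?_ ?_
    · exact (congrArg (Γ.graph.Adj · (q.1 1)) hpq.1).mpr (q.2.2 0)
    · exact (congrArg (Γ.graph.Adj (q.1 1)) hpq.2).mpr (q.2.2 1)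
  · rfl

theorem ofCoeff_zero {s : Bool} : ofCoeff Γ s (fun _ _ _ _ => 0) = 0 := by
  ext p q
  simp [ofCoeff]

theorem ofCoeff_mem_box {s : Bool} (c : V → V → V → V → ℂ) : ofCoeff Γ s c ∈ box Γ s 2 :=
  fun _ _ h => if_neg h

theorem ofCoeff_add {s : Bool} (c d : V → V → V → V → ℂ) :
    ofCoeff Γ s c + ofCoeff Γ s d = ofCoeff Γ s fun w x y z => c w x y z + d w x y z := by
  ext p q
  simp only [ofCoeff, Matrix.add_apply]
  split_ifs <;> simp

theorem ofCoeff_smul {s : Bool} (a : ℂ) (c : V → V → V → V → ℂ) :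
    a • ofCoeff Γ s c = ofCoeff Γ s fun w x y z => a * c w x y z := by
  ext p q
  simp only [ofCoeff, Matrix.smul_apply]
  split_ifs <;> simp

theorem one_eq_ofCoeff {s : Bool} :
    (1 : Matrix (Path Γ s 2) (Path Γ s 2) ℂ) =
      ofCoeff Γ s fun _ x _ z => if x = z then 1 else 0 := by
  ext p q
  have h : p = q ↔ p.1 0 = q.1 0 ∧ p.1 2 = q.1 2 ∧ p.1 1 = q.1 1 := by
    refine ⟨by rintro rfl; simp, fun ⟨h0, h2, h1⟩ => Subtype.ext (funext fun i => ?_)⟩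
    fin_cases i
    exacts [h0, h1, h2]
  simp only [ofCoeff, Matrix.one_apply, h]
  grind

theorem cup_mul_apply {s : Bool} {α : Type} (X : Matrix (Path Γ s 0) α ℂ) (p : Path Γ s 2)
    (r : Path Γ s 0) (h : p.1 0 = r.1 0) (a : α) : (cup Γ s * X) p a =
      if p.1 2 = p.1 0 then (√(Γ.weight (p.1 1) / Γ.weight (p.1 0)) : ℂ) * X r a else 0 := by
  rw [Matrix.mul_apply, Finset.sum_eq_single r]
  · simp only [cup_apply]
    grind
  · intro r' _ hr
    have : p.1 0 ≠ r'.1 0 := fun h' => hr (Subtype.ext (funext fun i => by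
      fin_cases i; exact h'.symm.trans h))
    simp [cup_apply, this]
  · simp

theorem cupcap_eq_ofCoeff {s : Bool} : cupcap Γ s = ofCoeff Γ s fun w x y z =>
    if w = y then (√(Γ.weight x / Γ.weight w) * √(Γ.weight z / Γ.weight w) : ℂ) else 0 := by
  ext p q
  let r : Path Γ s 0 := ⟨fun _ => p.1 0, p.2.1, fun i => i.elim0⟩
  rw [cupcap, cup_mul_apply _ p r rfl, cap_apply]
  change (if _ then _ * (if q.1 0 = p.1 0 ∧ q.1 2 = p.1 0 then _ else _) else _) = _
  simp only [ofCoeff]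
  grind

theorem cap_mul_cup {s : Bool} : cap Γ s * cup Γ s = (Γ.modulus : ℂ) • 1 := by
  ext p q
  have hp := p.2.1
  trans ∑ r : Path Γ s 2, (fun a b d => if p.1 0 = a then if p.1 0 = d then
    if p.1 0 = q.1 0 then (Γ.weight b / Γ.weight (p.1 0) : ℂ) else 0 else 0 else 0)
      (r.1 0) (r.1 1) (r.1 2)
  · rw [Matrix.mul_apply]
    refine Finset.sum_congr rfl fun r _ => ?_
    have h := sqrt_mul_sqrt_weight (Γ := Γ) (r.1 1) (r.1 0)
    rw [cap_apply, cup_apply]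
    grind
  · rw [sum_path_two fun a b d => if p.1 0 = a then if p.1 0 = d then
      if p.1 0 = q.1 0 then (Γ.weight b / Γ.weight (p.1 0) : ℂ) else 0 else 0 else 0]
    have hpq : p = q ↔ p.1 0 = q.1 0 := by
      refine ⟨by rintro rfl; rfl, fun h => Subtype.ext (funext fun i => ?_)⟩
      fin_cases i
      exact h
    rw [Matrix.smul_apply, Matrix.one_apply]
    simp only [mul_ite, mul_zero, Finset.sum_ite_irrel, Finset.sum_const_zero,
      Finset.sum_ite_eq, Finset.mem_univ, if_true, hp, one_mul, hpq, smul_eq_mul, mul_one]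
    split_ifs
    · rw [← sum_adj_weight (Γ := Γ) (p.1 0)]
      refine Finset.sum_congr rfl fun v _ => ?_
      rw [adj_comm Γ v, SimpleGraph.adjMatrix_apply]
      split_ifs <;> simp
    · rfl

theorem rotate_one {s t : Bool} (h : t = !s) :
    rotate h (1 : Matrix (Path Γ s 2) (Path Γ s 2) ℂ) = cupcap Γ t := by
  rw [one_eq_ofCoeff, rotate_ofCoeff, cupcap_eq_ofCoeff]
  congr 1
  funext w x y z
  grind

theorem rotate_cupcap {s t : Bool} (h : t = !s) : rotate h (cupcap Γ s) = 1 := by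
  rw [one_eq_ofCoeff, cupcap_eq_ofCoeff, rotate_ofCoeff]
  congr 1
  funext w x y z
  have h1 := sqrt_div_mul_sqrt_div (Γ := Γ) x w
  have h2 := sqrt_div_mul_sqrt_div (Γ := Γ) x y
  split_ifs with hxz
  · subst hxz
    linear_combination h1 * (√(Γ.weight x / Γ.weight y) * √(Γ.weight y / Γ.weight x)) + h2
  · simp

theorem rotateTwice_ofCoeff (c : V → V → V → V → ℂ) :
    rotateTwice (ofCoeff Γ true c) = ofCoeff Γ true fun w x y z => c y z w x := by
  rw [rotateTwice, rotate_ofCoeff, rotate_ofCoeff]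
  congr 1
  funext w x y z
  have h1 := sqrt_div_mul_sqrt_div (Γ := Γ) x w
  have h2 := sqrt_div_mul_sqrt_div (Γ := Γ) x y
  have h3 := sqrt_div_mul_sqrt_div (Γ := Γ) z y
  have h4 := sqrt_div_mul_sqrt_div_trans (Γ := Γ) x w z
  have h5 := sqrt_div_mul_sqrt_div_trans (Γ := Γ) z y x
  have h6 := sqrt_div_mul_sqrt_div (Γ := Γ) x z
  linear_combination c y z w x * (h4 * (√(Γ.weight z / Γ.weight y) * √(Γ.weight y / Γ.weight x)) +
    √(Γ.weight x / Γ.weight z) * h5 + h6)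

/-- The rotation turns stacking into the horizontal product, with the marked regions of the
factors moved by two clicks. -/
theorem horizontalMul_rotateTwice (c d : V → V → V → V → ℂ) :
    horizontalMul (rotateTwice (ofCoeff Γ true c)) (rotateTwice (ofCoeff Γ true d)) =
      rotate (s := false) rfl (rotate (t := false) rfl (ofCoeff Γ true d) *
        rotate (t := false) rfl (ofCoeff Γ true c)) := by
  rw [rotateTwice_ofCoeff, rotateTwice_ofCoeff, horizontalMul_ofCoeff, rotate_ofCoeff,
    rotate_ofCoeff, ofCoeff_mul, rotate_ofCoeff]
  congr 1
  funext w x y z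
  rw [Finset.mul_sum]
  refine Finset.sum_congr rfl fun v _ => ?_
  have h1 := sqrt_div_mul_sqrt_div_trans (Γ := Γ) x w z
  have h2 := sqrt_div_mul_sqrt_div_trans (Γ := Γ) z y x
  have h3 := sqrt_div_mul_sqrt_div (Γ := Γ) x z
  grind

theorem capRight_one {s t : Bool} (h : s = !t) :
    capRight h (1 : Matrix (Path Γ s 2) (Path Γ s 2) ℂ) = (Γ.modulus : ℂ) • 1 := by
  rw [one_eq_ofCoeff, capRight_ofCoeff, ← Matrix.diagonal_one, ← Matrix.diagonal_smul]
  congr 1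
  funext p
  simp only [if_true, mul_one, sum_adj_weight, Pi.smul_apply, smul_eq_mul]

theorem capRight_cupcap {s t : Bool} (h : s = !t) : capRight h (cupcap Γ s) = 1 := by
  rw [cupcap_eq_ofCoeff, capRight_ofCoeff, ← Matrix.diagonal_one]
  congr 1
  funext p
  have h1 : Γ.graph.adjMatrix ℂ (p.1 0) (p.1 1) = 1 := adj_one p 0
  have hv : (Γ.weight (p.1 0) : ℂ) ≠ 0 := by exact_mod_cast (Γ.weight_pos _).ne'
  have hw : (Γ.weight (p.1 1) : ℂ) ≠ 0 := by exact_mod_cast (Γ.weight_pos _).ne'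
  simp only [mul_ite, mul_zero, Finset.sum_ite_eq, Finset.mem_univ, if_true,
    sqrt_mul_sqrt_weight, adj_comm Γ (p.1 1), h1]
  field_simp

theorem capRight_ofCoeff_eq_zero {s t : Bool} (h : s = !t) {c : V → V → V → V → ℂ}
    (hc : ∀ w, Γ.even w = s → ∀ x, Γ.graph.Adj w x → ∑ v, Γ.graph.adjMatrix ℂ x v *
      (Γ.weight v / Γ.weight x * c w x v x) = 0) : capRight h (ofCoeff Γ s c) = 0 := by
  rw [capRight_ofCoeff, ← Matrix.diagonal_zero]
  congr 1
  funext p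
  exact hc _ p.2.1 _ (p.2.2 0)

theorem capLeft_ofCoeff_eq_zero {s t : Bool} (h : t = !s) {c : V → V → V → V → ℂ}
    (hc : ∀ w, Γ.even w = t → ∀ x, Γ.graph.Adj w x → ∑ v, Γ.graph.adjMatrix ℂ w v *
      (Γ.weight v / Γ.weight w * c v w x w) = 0) : capLeft h (ofCoeff Γ s c) = 0 := by
  rw [capLeft_ofCoeff, ← Matrix.diagonal_zero]
  congr 1
  funext p
  exact hc _ p.2.1 _ (p.2.2 0)

theorem addRight_add {s : Bool} {m n : ℕ} (X Y : Matrix (Path Γ s n) (Path Γ s m) ℂ) :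
    addRight (X + Y) = addRight X + addRight Y := by
  ext p q
  simp only [addRight, Matrix.add_apply]
  split_ifs <;> simp

theorem addRight_smul {s : Bool} {m n : ℕ} (a : ℂ) (X : Matrix (Path Γ s n) (Path Γ s m) ℂ) :
    addRight (a • X) = a • addRight X := by
  ext p q
  simp only [addRight, Matrix.smul_apply]
  split_ifs <;> simp

theorem addLeft_add {s t : Bool} (h : t = !s) {m n : ℕ}
    (X Y : Matrix (Path Γ s n) (Path Γ s m) ℂ) :
    addLeft h (X + Y) = addLeft h X + addLeft h Y := by
  ext p q
  simp only [addLeft, Matrix.add_apply]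
  split_ifs <;> simp

theorem addLeft_smul {s t : Bool} (h : t = !s) {m n : ℕ} (a : ℂ)
    (X : Matrix (Path Γ s n) (Path Γ s m) ℂ) : addLeft h (a • X) = a • addLeft h X := by
  ext p q
  simp only [addLeft, Matrix.smul_apply]
  split_ifs <;> simp

theorem rotate_add {s t : Bool} (h : t = !s) (X Y : Matrix (Path Γ s 2) (Path Γ s 2) ℂ) :
    rotate h (X + Y) = rotate h X + rotate h Y := by
  simp only [rotate, addRight_add, addLeft_add, Matrix.mul_add, Matrix.add_mul]

theorem rotate_smul {s t : Bool} (h : t = !s) (a : ℂ) (X : Matrix (Path Γ s 2) (Path Γ s 2) ℂ) :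
    rotate h (a • X) = a • rotate h X := by
  simp only [rotate, addRight_smul, addLeft_smul, Matrix.mul_smul, Matrix.smul_mul]

theorem capRight_add {s t : Bool} (h : s = !t) (X Y : Matrix (Path Γ s 2) (Path Γ s 2) ℂ) :
    capRight h (X + Y) = capRight h X + capRight h Y := by
  simp only [capRight, addRight_add, Matrix.mul_add, Matrix.add_mul]

theorem capRight_smul {s t : Bool} (h : s = !t) (a : ℂ)
    (X : Matrix (Path Γ s 2) (Path Γ s 2) ℂ) : capRight h (a • X) = a • capRight h X := by
  simp only [capRight, addRight_smul, Matrix.mul_smul, Matrix.smul_mul]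

/-! ### The two sides of the braid relation -/

theorem addRight_ofCoeff_apply {s : Bool} (c : V → V → V → V → ℂ) (p q : Path Γ s 3) :
    addRight (ofCoeff Γ s c) p q = if p.1 3 = q.1 3 then if p.1 0 = q.1 0 ∧ p.1 2 = q.1 2 then
      c (p.1 0) (p.1 1) (p.1 2) (q.1 1) else 0 else 0 := rfl

theorem addLeft_ofCoeff_apply {s t : Bool} (h : t = !s) (d : V → V → V → V → ℂ)
    (p q : Path Γ t 3) :
    addLeft h (ofCoeff Γ s d) p q = if p.1 0 = q.1 0 then if p.1 1 = q.1 1 ∧ p.1 3 = q.1 3 then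
      d (p.1 1) (p.1 2) (p.1 3) (q.1 2) else 0 else 0 := rfl

/-- The product `X₁ Y₂ X₁` in the space of 3-boxes. The vertex `v` is the region enclosed by the
three boxes. -/
theorem addRight_mul_addLeft_mul_addRight {s t : Bool} (h : t = !s) (c d : V → V → V → V → ℂ)
    (p q : Path Γ t 3) :
    (addRight (ofCoeff Γ t c) * addLeft h (ofCoeff Γ s d) * addRight (ofCoeff Γ t c)) p q =
      if p.1 0 = q.1 0 then if p.1 3 = q.1 3 then
        ∑ v, Γ.graph.adjMatrix ℂ (p.1 0) v * (Γ.graph.adjMatrix ℂ v (p.1 2) *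
          (Γ.graph.adjMatrix ℂ v (q.1 2) * (c (p.1 0) (p.1 1) (p.1 2) v *
            d v (p.1 2) (p.1 3) (q.1 2) * c (p.1 0) v (q.1 2) (q.1 1)))) else 0 else 0 := by
  have h0 := p.2.1
  have h3 : Γ.graph.adjMatrix ℂ (p.1 2) (p.1 3) = 1 := adj_one p 2
  have h3' : Γ.graph.adjMatrix ℂ (q.1 2) (q.1 3) = 1 := adj_one q 2
  rw [Matrix.mul_apply]
  trans ∑ y : Path Γ t 3, (fun a v e f => if p.1 0 = a then if q.1 2 = e then if p.1 3 = f then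
    if p.1 0 = q.1 0 then if p.1 3 = q.1 3 then (Γ.graph.adjMatrix ℂ v (p.1 2) *
      (c (p.1 0) (p.1 1) (p.1 2) v * d v (p.1 2) (p.1 3) (q.1 2) * c (p.1 0) v (q.1 2) (q.1 1)) : ℂ)
      else 0 else 0 else 0 else 0 else 0) (y.1 0) (y.1 1) (y.1 2) (y.1 3)
  · refine Finset.sum_congr rfl fun y _ => ?_
    have h4 : Γ.graph.adjMatrix ℂ (y.1 0) (y.1 1) = 1 := adj_one y 0
    by_cases hy : q.1 0 = y.1 0 ∧ q.1 2 = y.1 2 ∧ q.1 3 = y.1 3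
    · obtain ⟨y0, y2, y3⟩ := hy
      rw [addRight_ofCoeff_apply, if_pos y3.symm, if_pos ⟨y0.symm, y2.symm⟩, Matrix.mul_apply,
        Finset.sum_mul]
      by_cases hv : p.1 0 = q.1 0 ∧ p.1 3 = q.1 3 ∧ Γ.graph.adjMatrix ℂ (y.1 1) (p.1 2) = 1
      · obtain ⟨p0, p3, hv⟩ := hv
        simp only [← y0, ← y2, ← y3, p0, p3, hv, if_true]
        rw [← sum_path_three_ite h0 (p0 ▸ y0 ▸ h4) hv h3 (1 * _)]
        refine Finset.sum_congr rfl fun x _ => ?_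
        rw [addRight_ofCoeff_apply, addLeft_ofCoeff_apply]
        grind
      · have hr : ∀ x : Path Γ t 3, Γ.graph.adjMatrix ℂ (x.1 1) (x.1 2) = 1 := fun x => adj_one x 1
        have hv' : Γ.graph.adjMatrix ℂ (y.1 1) (p.1 2) ≠ 1 →
          Γ.graph.adjMatrix ℂ (y.1 1) (p.1 2) = 0 := by simp
        rw [Finset.sum_eq_zero]
        · grind
        · intro x _
          have hx := hr x
          rw [addRight_ofCoeff_apply, addLeft_ofCoeff_apply]
          grind
    · rw [addRight_ofCoeff_apply]
      grind
  · rw [sum_path_three fun a v e f => if p.1 0 = a then if q.1 2 = e then if p.1 3 = f then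
      if p.1 0 = q.1 0 then if p.1 3 = q.1 3 then (Γ.graph.adjMatrix ℂ v (p.1 2) *
      (c (p.1 0) (p.1 1) (p.1 2) v * d v (p.1 2) (p.1 3) (q.1 2) * c (p.1 0) v (q.1 2) (q.1 1)) : ℂ)
      else 0 else 0 else 0 else 0 else 0]
    simp only [mul_ite, mul_zero, Finset.sum_ite_irrel, Finset.sum_const_zero,
      Finset.sum_ite_eq, Finset.mem_univ, if_true, h0, one_mul]
    split_ifs with p0 p3
    · refine Finset.sum_congr rfl fun v _ => ?_
      rw [p3, h3']
      ring
    · rfl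
    · rfl

/-- The product `Y₂ X₁ Y₂` in the space of 3-boxes. -/
theorem addLeft_mul_addRight_mul_addLeft {s t : Bool} (h : t = !s) (c d : V → V → V → V → ℂ)
    (p q : Path Γ t 3) :
    (addLeft h (ofCoeff Γ s d) * addRight (ofCoeff Γ t c) * addLeft h (ofCoeff Γ s d)) p q =
      if p.1 0 = q.1 0 then if p.1 3 = q.1 3 then
        ∑ v, Γ.graph.adjMatrix ℂ (p.1 3) v * (Γ.graph.adjMatrix ℂ v (p.1 1) *
          (Γ.graph.adjMatrix ℂ v (q.1 1) * (d (p.1 1) (p.1 2) (p.1 3) v *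
            c (p.1 0) (p.1 1) v (q.1 1) * d (q.1 1) v (p.1 3) (q.1 2)))) else 0 else 0 := by
  have h0 := p.2.1
  have h3 : Γ.graph.adjMatrix ℂ (p.1 0) (p.1 1) = 1 := adj_one p 0
  have h3' : Γ.graph.adjMatrix ℂ (q.1 0) (q.1 1) = 1 := adj_one q 0
  rw [Matrix.mul_apply]
  trans ∑ y : Path Γ t 3, (fun a e v f => if p.1 0 = a then if q.1 1 = e then if p.1 3 = f then
    if p.1 0 = q.1 0 then if p.1 3 = q.1 3 then (Γ.graph.adjMatrix ℂ v (p.1 1) *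
      (d (p.1 1) (p.1 2) (p.1 3) v * c (p.1 0) (p.1 1) v (q.1 1) * d (q.1 1) v (p.1 3) (q.1 2)) : ℂ)
      else 0 else 0 else 0 else 0 else 0) (y.1 0) (y.1 1) (y.1 2) (y.1 3)
  · refine Finset.sum_congr rfl fun y _ => ?_
    have h4 : Γ.graph.adjMatrix ℂ (y.1 2) (y.1 3) = 1 := adj_one y 2
    by_cases hy : q.1 0 = y.1 0 ∧ q.1 1 = y.1 1 ∧ q.1 3 = y.1 3
    · obtain ⟨y0, y1, y3⟩ := hy
      rw [addLeft_ofCoeff_apply, if_pos y0.symm, if_pos ⟨y1.symm, y3.symm⟩, Matrix.mul_apply,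
        Finset.sum_mul]
      by_cases hv : p.1 0 = q.1 0 ∧ p.1 3 = q.1 3 ∧ Γ.graph.adjMatrix ℂ (y.1 2) (p.1 1) = 1
      · obtain ⟨p0, p3, hv⟩ := hv
        simp only [← y0, ← y1, ← y3, p0, p3, hv, if_true]
        rw [← sum_path_three_ite h0 h3 (adj_comm Γ _ _ ▸ hv) (p3 ▸ y3 ▸ h4) (1 * _)]
        refine Finset.sum_congr rfl fun x _ => ?_
        rw [addRight_ofCoeff_apply, addLeft_ofCoeff_apply]
        grind
      · have hr : ∀ x : Path Γ t 3, Γ.graph.adjMatrix ℂ (x.1 2) (x.1 1) = 1 := fun x =>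
          adj_comm Γ _ _ ▸ adj_one x 1
        have hv' : Γ.graph.adjMatrix ℂ (y.1 2) (p.1 1) ≠ 1 →
          Γ.graph.adjMatrix ℂ (y.1 2) (p.1 1) = 0 := by simp
        rw [Finset.sum_eq_zero]
        · grind
        · intro x _
          have hx := hr x
          rw [addRight_ofCoeff_apply, addLeft_ofCoeff_apply]
          grind
    · rw [addLeft_ofCoeff_apply]
      grind
  · rw [sum_path_three fun a e v f => if p.1 0 = a then if q.1 1 = e then if p.1 3 = f then
      if p.1 0 = q.1 0 then if p.1 3 = q.1 3 then (Γ.graph.adjMatrix ℂ v (p.1 1) *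
      (d (p.1 1) (p.1 2) (p.1 3) v * c (p.1 0) (p.1 1) v (q.1 1) * d (q.1 1) v (p.1 3) (q.1 2)) : ℂ)
      else 0 else 0 else 0 else 0 else 0]
    simp only [mul_ite, mul_zero, Finset.sum_ite_irrel, Finset.sum_const_zero,
      Finset.sum_ite_eq, Finset.mem_univ, if_true, h0, one_mul]
    split_ifs with p0 p3
    · refine Finset.sum_congr rfl fun v _ => ?_
      rw [p0, h3', adj_comm Γ (p.1 3), adj_comm Γ (q.1 1)]
      ring
    · rfl
    · rfl

end General

/-! ### The graph and the element `A` -/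

theorem shuriken_adj (v w : Fin 8) : shuriken.graph.Adj v w ↔ (v, w) ∈
    ([(0, 7), (7, 0), (7, 4), (4, 7), (7, 6), (6, 7), (4, 3), (3, 4), (4, 5), (5, 4), (6, 5),
      (5, 6), (6, 1), (1, 6), (5, 2), (2, 5)] : List (Fin 8 × Fin 8)) := by
  revert v w
  decide

theorem shuriken_even (v : Fin 8) : shuriken.even v = decide (v ∈ ([0, 2, 4, 6] : List (Fin 8))) :=
  rfl

theorem forall_adj_values {P : Fin 8 → Prop} :
    ((∀ v, shuriken.graph.Adj 0 v → P v) ↔ P 7) ∧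
    ((∀ v, shuriken.graph.Adj 1 v → P v) ↔ P 6) ∧
    ((∀ v, shuriken.graph.Adj 2 v → P v) ↔ P 5) ∧
    ((∀ v, shuriken.graph.Adj 3 v → P v) ↔ P 4) ∧
    ((∀ v, shuriken.graph.Adj 4 v → P v) ↔ P 3 ∧ P 5 ∧ P 7) ∧
    ((∀ v, shuriken.graph.Adj 5 v → P v) ↔ P 2 ∧ P 4 ∧ P 6) ∧
    ((∀ v, shuriken.graph.Adj 6 v → P v) ↔ P 1 ∧ P 5 ∧ P 7) ∧
    ((∀ v, shuriken.graph.Adj 7 v → P v) ↔ P 0 ∧ P 4 ∧ P 6) := by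
  simp only [shuriken_adj, Fin.forall_fin_succ]
  simp

theorem forall_even {P : Fin 8 → Prop} :
    (∀ v, shuriken.even v = true → P v) ↔ P 0 ∧ P 2 ∧ P 4 ∧ P 6 := by
  simp [shuriken_even]

theorem forall_odd {P : Fin 8 → Prop} :
    (∀ v, shuriken.even v = false → P v) ↔ P 1 ∧ P 3 ∧ P 5 ∧ P 7 := by
  simp [shuriken_even, Fin.forall_fin_succ]

theorem sum_adj_values (f : Fin 8 → ℂ) :
    ∑ v, shuriken.graph.adjMatrix ℂ 0 v * f v = f 7 ∧
    ∑ v, shuriken.graph.adjMatrix ℂ 1 v * f v = f 6 ∧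
    ∑ v, shuriken.graph.adjMatrix ℂ 2 v * f v = f 5 ∧
    ∑ v, shuriken.graph.adjMatrix ℂ 3 v * f v = f 4 ∧
    ∑ v, shuriken.graph.adjMatrix ℂ 4 v * f v = f 3 + f 5 + f 7 ∧
    ∑ v, shuriken.graph.adjMatrix ℂ 5 v * f v = f 2 + f 4 + f 6 ∧
    ∑ v, shuriken.graph.adjMatrix ℂ 6 v * f v = f 1 + f 5 + f 7 ∧
    ∑ v, shuriken.graph.adjMatrix ℂ 7 v * f v = f 0 + f 4 + f 6 := by
  simp [Fin.sum_univ_eight, shuriken_adj]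

theorem shuriken_adj_values :
    ¬shuriken.graph.Adj 0 1 ∧ ¬shuriken.graph.Adj 0 3 ∧ ¬shuriken.graph.Adj 0 5 ∧
    shuriken.graph.Adj 0 7 ∧ ¬shuriken.graph.Adj 2 1 ∧ ¬shuriken.graph.Adj 2 3 ∧
    shuriken.graph.Adj 2 5 ∧ ¬shuriken.graph.Adj 2 7 ∧ ¬shuriken.graph.Adj 4 1 ∧
    shuriken.graph.Adj 4 3 ∧ shuriken.graph.Adj 4 5 ∧ shuriken.graph.Adj 4 7 ∧
    shuriken.graph.Adj 6 1 ∧ ¬shuriken.graph.Adj 6 3 ∧ shuriken.graph.Adj 6 5 ∧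
    shuriken.graph.Adj 6 7 ∧ ¬shuriken.graph.Adj 1 0 ∧ ¬shuriken.graph.Adj 1 2 ∧
    ¬shuriken.graph.Adj 1 4 ∧ shuriken.graph.Adj 1 6 ∧ ¬shuriken.graph.Adj 3 0 ∧
    ¬shuriken.graph.Adj 3 2 ∧ shuriken.graph.Adj 3 4 ∧ ¬shuriken.graph.Adj 3 6 ∧
    ¬shuriken.graph.Adj 5 0 ∧ shuriken.graph.Adj 5 2 ∧ shuriken.graph.Adj 5 4 ∧
    shuriken.graph.Adj 5 6 ∧ shuriken.graph.Adj 7 0 ∧ ¬shuriken.graph.Adj 7 2 ∧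
    shuriken.graph.Adj 7 4 ∧ shuriken.graph.Adj 7 6 := by
  simp [shuriken_adj]

theorem adjMatrix_values :
    shuriken.graph.adjMatrix ℂ 0 1 = 0 ∧ shuriken.graph.adjMatrix ℂ 0 3 = 0 ∧
    shuriken.graph.adjMatrix ℂ 0 5 = 0 ∧ shuriken.graph.adjMatrix ℂ 0 7 = 1 ∧
    shuriken.graph.adjMatrix ℂ 2 1 = 0 ∧ shuriken.graph.adjMatrix ℂ 2 3 = 0 ∧
    shuriken.graph.adjMatrix ℂ 2 5 = 1 ∧ shuriken.graph.adjMatrix ℂ 2 7 = 0 ∧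
    shuriken.graph.adjMatrix ℂ 4 1 = 0 ∧ shuriken.graph.adjMatrix ℂ 4 3 = 1 ∧
    shuriken.graph.adjMatrix ℂ 4 5 = 1 ∧ shuriken.graph.adjMatrix ℂ 4 7 = 1 ∧
    shuriken.graph.adjMatrix ℂ 6 1 = 1 ∧ shuriken.graph.adjMatrix ℂ 6 3 = 0 ∧
    shuriken.graph.adjMatrix ℂ 6 5 = 1 ∧ shuriken.graph.adjMatrix ℂ 6 7 = 1 ∧
    shuriken.graph.adjMatrix ℂ 1 0 = 0 ∧ shuriken.graph.adjMatrix ℂ 1 2 = 0 ∧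
    shuriken.graph.adjMatrix ℂ 1 4 = 0 ∧ shuriken.graph.adjMatrix ℂ 1 6 = 1 ∧
    shuriken.graph.adjMatrix ℂ 3 0 = 0 ∧ shuriken.graph.adjMatrix ℂ 3 2 = 0 ∧
    shuriken.graph.adjMatrix ℂ 3 4 = 1 ∧ shuriken.graph.adjMatrix ℂ 3 6 = 0 ∧
    shuriken.graph.adjMatrix ℂ 5 0 = 0 ∧ shuriken.graph.adjMatrix ℂ 5 2 = 1 ∧
    shuriken.graph.adjMatrix ℂ 5 4 = 1 ∧ shuriken.graph.adjMatrix ℂ 5 6 = 1 ∧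
    shuriken.graph.adjMatrix ℂ 7 0 = 1 ∧ shuriken.graph.adjMatrix ℂ 7 2 = 0 ∧
    shuriken.graph.adjMatrix ℂ 7 4 = 1 ∧ shuriken.graph.adjMatrix ℂ 7 6 = 1 := by
  simp [shuriken_adj]

/-- The number `δ^{-1/2}`, with square `√2 - 1`. -/
noncomputable def tau : ℂ := (√(1 + √2) : ℂ)⁻¹

theorem sqrtTwo_mul_self : (√2 : ℂ) * √2 = 2 := by
  rw [← Complex.ofReal_mul, Real.mul_self_sqrt (by norm_num)]
  norm_num

theorem tau_mul_self : tau * tau = √2 - 1 := by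
  have h := sqrtTwo_mul_self
  have h1 : (√(1 + √2) : ℂ) * √(1 + √2) = 1 + √2 := by
    rw [← Complex.ofReal_mul, Real.mul_self_sqrt (by positivity)]
    simp
  have h0 : (√(1 + √2) : ℂ) ≠ 0 := by
    have : √(1 + √2) ≠ 0 := by positivity
    exact_mod_cast this
  rw [tau, ← mul_inv, h1]
  have h2 : (1 + √2 : ℂ) ≠ 0 := by rw [← h1]; exact mul_ne_zero h0 h0
  rw [inv_eq_iff_eq_inv, ← one_div, eq_div_iff]
  · linear_combination h
  · intro h3
    have : (√2 : ℂ) = 1 := by linear_combination h3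
    rw [this] at h
    norm_num at h

theorem modulus_inv : (1 + √2 : ℂ)⁻¹ = √2 - 1 := by
  rw [inv_eq_of_mul_eq_one_right]
  linear_combination sqrtTwo_mul_self

theorem sqrt_modulus : (√(1 + √2) : ℂ) = tau * (1 + √2) := by
  have h1 : (√(1 + √2) : ℂ) * √(1 + √2) = 1 + √2 := by
    rw [← Complex.ofReal_mul, Real.mul_self_sqrt (by positivity)]
    simp
  have h0 : (√(1 + √2) : ℂ) ≠ 0 := by
    have : √(1 + √2) ≠ 0 := by positivity
    exact_mod_cast this
  rw [← h1, tau, inv_mul_cancel_left₀ h0]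

/-- The spin factors on the graph: they are `1` except between a vertex of weight `1` and one of
weight `δ = τ⁻²`. -/
theorem spin_eq (v w : Fin 8) : (√(shuriken.weight v / shuriken.weight w) : ℂ) =
    if v < 4 then if w < 4 then 1 else tau else if w < 4 then tau * (1 + √2) else 1 := by
  have h : (1 + √2 : ℝ) ≠ 0 := by positivity
  simp only [shuriken]
  split_ifs
  · simp
  · simp [tau]
  · rw [div_one, sqrt_modulus]
  · simp [h]

/-- The coefficients of `A(lam)` at the 36 loops of length 4 based at even vertices, with the powers
of `δ` written as polynomials in `√2` and `tau`. -/
theorem coeffA_values (lam : ℂ) :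
    coeffA lam 0 7 0 7 = 0 ∧ coeffA lam 0 7 4 7 = -1 ∧ coeffA lam 0 7 6 7 = 1 ∧
    coeffA lam 2 5 2 5 = 0 ∧ coeffA lam 2 5 4 5 = 1 ∧ coeffA lam 2 5 6 5 = -1 ∧
    coeffA lam 4 3 4 3 = 0 ∧ coeffA lam 4 3 4 5 = tau ∧ coeffA lam 4 3 4 7 = -tau ∧
    coeffA lam 4 5 2 5 = 1 ∧ coeffA lam 4 5 4 3 = tau ∧ coeffA lam 4 5 4 5 = 1 - √2 ∧
    coeffA lam 4 5 4 7 = 0 ∧ coeffA lam 4 5 6 5 = 0 ∧ coeffA lam 4 5 6 7 = lam ∧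
    coeffA lam 4 7 0 7 = -1 ∧ coeffA lam 4 7 4 3 = -tau ∧ coeffA lam 4 7 4 5 = 0 ∧
    coeffA lam 4 7 4 7 = √2 - 1 ∧ coeffA lam 4 7 6 5 = conj lam ∧ coeffA lam 4 7 6 7 = 0 ∧
    coeffA lam 6 1 6 1 = 0 ∧ coeffA lam 6 1 6 5 = -tau ∧ coeffA lam 6 1 6 7 = tau ∧
    coeffA lam 6 5 2 5 = -1 ∧ coeffA lam 6 5 4 5 = 0 ∧ coeffA lam 6 5 4 7 = conj lam ∧
    coeffA lam 6 5 6 1 = -tau ∧ coeffA lam 6 5 6 5 = √2 - 1 ∧ coeffA lam 6 5 6 7 = 0 ∧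
    coeffA lam 6 7 0 7 = 1 ∧ coeffA lam 6 7 4 5 = lam ∧ coeffA lam 6 7 4 7 = 0 ∧
    coeffA lam 6 7 6 1 = tau ∧ coeffA lam 6 7 6 5 = 0 ∧ coeffA lam 6 7 6 7 = 1 - √2 := by
  have h1 := modulus_inv
  have h2 : (√(1 + √2) : ℂ)⁻¹ = tau := rfl
  simp only [coeffA, h1, h2, neg_sub, and_self]

theorem elementA_eq (lam : ℂ) : elementA lam = ofCoeff shuriken true (coeffA lam) := rfl

/-- The automorphism `2k ↔ 2k + 1` of the graph. It exchanges even and odd vertices and preserves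
the weights. -/
def swap : Fin 8 → Fin 8 := ![1, 0, 3, 2, 5, 4, 7, 6]

theorem swap_values : swap 0 = 1 ∧ swap 1 = 0 ∧ swap 2 = 3 ∧ swap 3 = 2 ∧ swap 4 = 5 ∧
    swap 5 = 4 ∧ swap 6 = 7 ∧ swap 7 = 6 := by
  decide

/-- The coefficients of `ℱ(A(lam))`, in terms of those of `A` at the conjugate parameter. -/
noncomputable def coeffB (lam : ℂ) (w x y z : Fin 8) : ℂ :=
  coeffA (conj lam) (swap w) (swap x) (swap y) (swap z)

theorem rotate_elementA (lam : ℂ) :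
    rotate (t := false) rfl (elementA lam) = ofCoeff shuriken false (coeffB lam) := by
  rw [elementA_eq, rotate_ofCoeff]
  refine ofCoeff_congr ?_
  have hs := sqrtTwo_mul_self
  have ht := tau_mul_self
  rw [forall_odd]
  simp only [forall_adj_values, shuriken_adj_values, forall_const, false_imp_iff, and_true,
    true_and]
  simp only [coeffB, swap_values, coeffA_values, Complex.conj_conj, spin_eq, Fin.reduceLT, if_true,
    if_false]
  grind only

theorem rotateTwice_elementA (lam : ℂ) : rotateTwice (elementA lam) = elementA lam := by
  rw [elementA_eq, rotateTwice_ofCoeff]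
  refine ofCoeff_congr ?_
  rw [forall_even]
  simp only [forall_adj_values, shuriken_adj_values, forall_const, false_imp_iff, and_true,
    coeffA_values]

theorem elementA_conjTranspose (lam : ℂ) : (elementA lam)ᴴ = elementA lam := by
  have key : (elementA lam)ᴴ = ofCoeff shuriken true fun w x y z => conj (coeffA lam w z y x) := by
    ext p q
    simp only [elementA_eq, ofCoeff, Matrix.conjTranspose_apply, Complex.star_def]
    grind
  have ht : conj tau = tau := by rw [tau, map_inv₀, Complex.conj_ofReal]
  rw [key, elementA_eq]
  refine ofCoeff_congr ?_
  rw [forall_even]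
  simp only [forall_adj_values, shuriken_adj_values, forall_const, false_imp_iff, and_true,
    true_and]
  simp only [coeffA_values, map_zero, map_one, map_neg, map_sub, Complex.conj_ofReal,
    Complex.conj_conj, ht, and_self]

theorem elementA_mul_self (lam : ℂ) (hlam : lam * conj lam = 1) :
    elementA lam * elementA lam = 1 + (1 - √2 : ℂ) • cupcap shuriken true := by
  rw [elementA_eq, ofCoeff_mul, one_eq_ofCoeff, cupcap_eq_ofCoeff, ofCoeff_smul, ofCoeff_add]
  refine ofCoeff_congr ?_
  have hs := sqrtTwo_mul_self
  have ht := tau_mul_self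
  rw [forall_even]
  simp only [forall_adj_values, shuriken_adj_values, forall_const, false_imp_iff, and_true,
    true_and]
  simp only [mul_assoc, sum_adj_values, adjMatrix_values, zero_mul, zero_add, add_zero, one_mul]
  simp only [coeffA_values, spin_eq, Fin.reduceEq, Fin.reduceLT, if_true, if_false]
  grind only

theorem ofCoeff_coeffB_mul_self (lam : ℂ) (hlam : lam * conj lam = 1) :
    ofCoeff shuriken false (coeffB lam) * ofCoeff shuriken false (coeffB lam) =
      1 + (1 - √2 : ℂ) • cupcap shuriken false := by
  rw [ofCoeff_mul, one_eq_ofCoeff, cupcap_eq_ofCoeff, ofCoeff_smul, ofCoeff_add]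
  refine ofCoeff_congr ?_
  have hs := sqrtTwo_mul_self
  have ht := tau_mul_self
  rw [forall_odd]
  simp only [forall_adj_values, shuriken_adj_values, forall_const, false_imp_iff, and_true,
    true_and]
  simp only [mul_assoc, sum_adj_values, adjMatrix_values, zero_mul, zero_add, add_zero, one_mul]
  simp only [coeffB, swap_values, coeffA_values, Complex.conj_conj, spin_eq, Fin.reduceEq,
    Fin.reduceLT, if_true, if_false]
  grind only

theorem cupcap_mul_elementA (lam : ℂ) : cupcap shuriken true * elementA lam = 0 := by
  rw [elementA_eq, cupcap_eq_ofCoeff, ofCoeff_mul, ← ofCoeff_zero]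
  refine ofCoeff_congr ?_
  have hs := sqrtTwo_mul_self
  have ht := tau_mul_self
  rw [forall_even]
  simp only [forall_adj_values, shuriken_adj_values, forall_const, false_imp_iff, and_true,
    true_and]
  simp only [mul_assoc, sum_adj_values, adjMatrix_values, zero_mul, zero_add, add_zero, one_mul]
  simp only [coeffA_values, spin_eq, Fin.reduceEq, Fin.reduceLT, if_true, if_false]
  grind only

theorem elementA_mul_cupcap (lam : ℂ) : elementA lam * cupcap shuriken true = 0 := by
  rw [elementA_eq, cupcap_eq_ofCoeff, ofCoeff_mul, ← ofCoeff_zero]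
  refine ofCoeff_congr ?_
  have hs := sqrtTwo_mul_self
  have ht := tau_mul_self
  rw [forall_even]
  simp only [forall_adj_values, shuriken_adj_values, forall_const, false_imp_iff, and_true,
    true_and]
  simp only [mul_assoc, sum_adj_values, adjMatrix_values, zero_mul, zero_add, add_zero, one_mul]
  simp only [coeffA_values, spin_eq, Fin.reduceEq, Fin.reduceLT, if_true, if_false]
  grind only

theorem cupcap_mul_ofCoeff_coeffB (lam : ℂ) :
    cupcap shuriken false * ofCoeff shuriken false (coeffB lam) = 0 := by
  rw [cupcap_eq_ofCoeff, ofCoeff_mul, ← ofCoeff_zero]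
  refine ofCoeff_congr ?_
  have hs := sqrtTwo_mul_self
  have ht := tau_mul_self
  rw [forall_odd]
  simp only [forall_adj_values, shuriken_adj_values, forall_const, false_imp_iff, and_true,
    true_and]
  simp only [mul_assoc, sum_adj_values, adjMatrix_values, zero_mul, zero_add, add_zero, one_mul]
  simp only [coeffB, swap_values, coeffA_values, Complex.conj_conj, spin_eq, Fin.reduceEq,
    Fin.reduceLT, if_true, if_false]
  grind only

theorem ofCoeff_coeffB_mul_cupcap (lam : ℂ) :
    ofCoeff shuriken false (coeffB lam) * cupcap shuriken false = 0 := by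
  rw [cupcap_eq_ofCoeff, ofCoeff_mul, ← ofCoeff_zero]
  refine ofCoeff_congr ?_
  have hs := sqrtTwo_mul_self
  have ht := tau_mul_self
  rw [forall_odd]
  simp only [forall_adj_values, shuriken_adj_values, forall_const, false_imp_iff, and_true,
    true_and]
  simp only [mul_assoc, sum_adj_values, adjMatrix_values, zero_mul, zero_add, add_zero, one_mul]
  simp only [coeffB, swap_values, coeffA_values, Complex.conj_conj, spin_eq, Fin.reduceEq,
    Fin.reduceLT, if_true, if_false]
  grind only

theorem weight_eq (v : Fin 8) :
    (shuriken.weight v : ℂ) = (if v < 4 then 1 else 1 + √2 : ℂ) := by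
  simp only [shuriken]
  split_ifs <;> simp

theorem capRight_elementA (lam : ℂ) :
    capRight (t := false) rfl (elementA lam) = 0 := by
  refine capRight_ofCoeff_eq_zero rfl ?_
  have hs := sqrtTwo_mul_self
  refine forall_even.2 ?_
  simp only [forall_adj_values, sum_adj_values]
  simp only [coeffA_values, weight_eq, Fin.reduceLT, if_true, if_false]
  grind only

theorem capLeft_elementA (lam : ℂ) :
    capLeft (t := false) rfl (elementA lam) = 0 := by
  refine capLeft_ofCoeff_eq_zero rfl ?_
  have hs := sqrtTwo_mul_self
  refine forall_odd.2 ?_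
  simp only [forall_adj_values, sum_adj_values]
  simp only [coeffA_values, weight_eq, Fin.reduceLT, if_true, if_false]
  grind only

theorem capRight_ofCoeff_coeffB (lam : ℂ) :
    capRight (t := true) rfl (ofCoeff shuriken false (coeffB lam)) = 0 := by
  refine capRight_ofCoeff_eq_zero rfl ?_
  have hs := sqrtTwo_mul_self
  refine forall_odd.2 ?_
  simp only [forall_adj_values, sum_adj_values]
  simp only [coeffB, swap_values, coeffA_values, weight_eq,
    Fin.reduceLT, if_true, if_false]
  grind only

/-- Coefficients of `i (1 - E) + A(lam)`, which is `√2 R(lam)`. -/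
noncomputable def coeffX (lam : ℂ) (w x y z : Fin 8) : ℂ :=
  Complex.I * ((if x = z then 1 else 0) - if w = y then
    (√(shuriken.weight x / shuriken.weight w) * √(shuriken.weight z / shuriken.weight w) : ℂ)
      else 0) + coeffA lam w x y z

/-- The coefficients of `√2 R(lam)` at the 36 loops of length 4 based at even vertices. -/
theorem coeffX_values (lam : ℂ) :
    coeffX lam 0 7 0 7 = -(Complex.I * √2) ∧ coeffX lam 0 7 4 7 = Complex.I - 1 ∧
    coeffX lam 0 7 6 7 = Complex.I + 1 ∧ coeffX lam 2 5 2 5 = -(Complex.I * √2) ∧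
    coeffX lam 2 5 4 5 = Complex.I + 1 ∧ coeffX lam 2 5 6 5 = Complex.I - 1 ∧
    coeffX lam 4 3 4 3 = Complex.I * (2 - √2) ∧ coeffX lam 4 3 4 5 = -(Complex.I * tau) + tau ∧
    coeffX lam 4 3 4 7 = -(Complex.I * tau) - tau ∧ coeffX lam 4 5 2 5 = Complex.I + 1 ∧
    coeffX lam 4 5 4 3 = -(Complex.I * tau) + tau ∧ coeffX lam 4 5 4 5 = 1 - √2 ∧
    coeffX lam 4 5 4 7 = -Complex.I ∧ coeffX lam 4 5 6 5 = Complex.I ∧ coeffX lam 4 5 6 7 = lam ∧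
    coeffX lam 4 7 0 7 = Complex.I - 1 ∧ coeffX lam 4 7 4 3 = -(Complex.I * tau) - tau ∧
    coeffX lam 4 7 4 5 = -Complex.I ∧ coeffX lam 4 7 4 7 = √2 - 1 ∧
    coeffX lam 4 7 6 5 = conj lam ∧ coeffX lam 4 7 6 7 = Complex.I ∧
    coeffX lam 6 1 6 1 = Complex.I * (2 - √2) ∧ coeffX lam 6 1 6 5 = -(Complex.I * tau) - tau ∧
    coeffX lam 6 1 6 7 = -(Complex.I * tau) + tau ∧ coeffX lam 6 5 2 5 = Complex.I - 1 ∧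
    coeffX lam 6 5 4 5 = Complex.I ∧ coeffX lam 6 5 4 7 = conj lam ∧
    coeffX lam 6 5 6 1 = -(Complex.I * tau) - tau ∧ coeffX lam 6 5 6 5 = √2 - 1 ∧
    coeffX lam 6 5 6 7 = -Complex.I ∧ coeffX lam 6 7 0 7 = Complex.I + 1 ∧
    coeffX lam 6 7 4 5 = lam ∧ coeffX lam 6 7 4 7 = Complex.I ∧
    coeffX lam 6 7 6 1 = -(Complex.I * tau) + tau ∧ coeffX lam 6 7 6 5 = -Complex.I ∧
    coeffX lam 6 7 6 7 = 1 - √2 := by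
  have hs := sqrtTwo_mul_self
  have ht := tau_mul_self
  simp only [coeffX, coeffA_values, spin_eq, Fin.reduceEq, Fin.reduceLT, if_true, if_false]
  grind

/-! ### The braid relation on the graph -/

theorem weight_swap (v : Fin 8) : shuriken.weight (swap v) = shuriken.weight v := by
  have h : swap v < 4 ↔ v < 4 := by
    revert v
    decide
  simp only [shuriken, h]

theorem swap_injective : Function.Injective swap := by
  decide

/-- Coefficients of `i (1 - E) + ℱ(A(lam))`, which is `√2 ℱ(R(lam)⁻¹)`. -/
noncomputable def coeffY (lam : ℂ) (w x y z : Fin 8) : ℂ :=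
  coeffX (conj lam) (swap w) (swap x) (swap y) (swap z)

theorem ofCoeff_coeffX (lam : ℂ) : ofCoeff shuriken true (coeffX lam) =
    Complex.I • (1 - cupcap shuriken true) + elementA lam := by
  rw [sub_eq_add_neg, ← neg_one_smul ℂ, one_eq_ofCoeff, cupcap_eq_ofCoeff, elementA_eq,
    ofCoeff_smul, ofCoeff_add, ofCoeff_smul, ofCoeff_add]
  congr 1
  funext w x y z
  rw [coeffX, neg_one_mul, sub_eq_add_neg]

theorem ofCoeff_coeffY (lam : ℂ) : ofCoeff shuriken false (coeffY lam) =
    Complex.I • (1 - cupcap shuriken false) + ofCoeff shuriken false (coeffB lam) := by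
  rw [sub_eq_add_neg, ← neg_one_smul ℂ, one_eq_ofCoeff, cupcap_eq_ofCoeff,
    ofCoeff_smul, ofCoeff_add, ofCoeff_smul, ofCoeff_add]
  congr 1
  funext w x y z
  simp only [coeffY, coeffX, coeffB, neg_one_mul, sub_eq_add_neg, weight_swap,
    swap_injective.eq_iff]

/-- The braid relation for `√2 R` and `√2 ℱ(R⁻¹)`, one equation for each hexagon `a b c d c' b'`. -/
theorem hexagon_relation (lam : ℂ) (hlam : lam * conj lam = 1) :
    ∀ a, shuriken.even a = true → ∀ b, shuriken.graph.Adj a b → ∀ c, shuriken.graph.Adj b c →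
    ∀ b', shuriken.graph.Adj a b' → ∀ c', shuriken.graph.Adj b' c' →
    ∀ d, shuriken.graph.Adj c d → shuriken.graph.Adj c' d →
    ∑ v, shuriken.graph.adjMatrix ℂ a v * (shuriken.graph.adjMatrix ℂ v c *
      (shuriken.graph.adjMatrix ℂ v c' *
        (coeffX lam a b c v * coeffY lam v c d c' * coeffX lam a v c' b'))) =
    ∑ v, shuriken.graph.adjMatrix ℂ d v * (shuriken.graph.adjMatrix ℂ v b *
      (shuriken.graph.adjMatrix ℂ v b' *
        (coeffY lam b c d v * coeffX lam a b v b' * coeffY lam b' v d c'))) := by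
  have hs := sqrtTwo_mul_self
  have ht := tau_mul_self
  have hi := Complex.I_mul_I
  rw [forall_even]
  simp only [forall_adj_values, shuriken_adj_values, forall_const, false_imp_iff, and_true,
    true_and]
  simp only [sum_adj_values, adjMatrix_values, zero_mul, zero_add, add_zero, one_mul]
  simp only [coeffY, swap_values, coeffX_values, Complex.conj_conj]
  -- the remaining equations are polynomial identities modulo the four relations in the context
  generalize conj lam = l' at *
  generalize (√2 : ℂ) = s at *
  generalize tau = t at *
  generalize Complex.I = i at *
  and_intros <;> grind only

theorem braid_coeffX_coeffY (lam : ℂ) (hlam : lam * conj lam = 1) :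
    addRight (ofCoeff shuriken true (coeffX lam)) *
      addLeft (t := true) rfl (ofCoeff shuriken false (coeffY lam)) *
        addRight (ofCoeff shuriken true (coeffX lam)) =
    addLeft (t := true) rfl (ofCoeff shuriken false (coeffY lam)) *
      addRight (ofCoeff shuriken true (coeffX lam)) *
        addLeft (t := true) rfl (ofCoeff shuriken false (coeffY lam)) := by
  ext p q
  rw [addRight_mul_addLeft_mul_addRight, addLeft_mul_addRight_mul_addLeft]
  split_ifs with h0 h3
  · refine hexagon_relation lam hlam _ p.2.1 _ (p.2.2 0) _ (p.2.2 1) _ ?_ _ (q.2.2 1) _ (p.2.2 2) ?_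
    · exact (congrArg (shuriken.graph.Adj · (q.1 1)) h0).mpr (q.2.2 0)
    · exact (congrArg (shuriken.graph.Adj (q.1 2)) h3).mpr (q.2.2 2)
  · rfl
  · rfl

/-! ### The braiding `R` -/

theorem modulus_eq : (shuriken.modulus : ℂ) = 1 + √2 := by
  simp [shuriken]

theorem modulus_ne_zero : (shuriken.modulus : ℂ) ≠ 0 := by
  have h : (0 : ℝ) < 1 + √2 := by positivity
  exact_mod_cast h.ne'

theorem jones_eq (s : Bool) : jones shuriken s = (√2 - 1 : ℂ) • cupcap shuriken s := by
  rw [jones, modulus_eq, modulus_inv]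

theorem jonesWenzl_eq (s : Bool) :
    jonesWenzl shuriken s = 1 + (1 - √2 : ℂ) • cupcap shuriken s := by
  rw [jonesWenzl, jones_eq]
  module

theorem cupcap_mul_self (s : Bool) :
    cupcap shuriken s * cupcap shuriken s = (1 + √2 : ℂ) • cupcap shuriken s := by
  rw [cupcap, Matrix.mul_assoc, ← Matrix.mul_assoc (cap shuriken s), cap_mul_cup, modulus_eq,
    Matrix.smul_mul, Matrix.one_mul, Matrix.mul_smul]

/-- In the algebra generated by `e` and `A` with `e² = δ e`, `e A = A e = 0` and
`A² = 1 - δ⁻¹ e`, the elements `(√2/2) (± z (1 - e) + A)` with `z² = -1` are mutually inverse. -/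
theorem mul_eq_one_of_sq {M : Type*} [Ring M] [Algebra ℂ M] {e A : M} {z : ℂ} (hz : z * z = -1)
    (he : e * e = (1 + √2 : ℂ) • e) (heA : e * A = 0) (hAe : A * e = 0)
    (hA : A * A = 1 + (1 - √2 : ℂ) • e) :
    ((√2 / 2 : ℂ) • (z • (1 - e) + A)) * ((√2 / 2 : ℂ) • (-z • (1 - e) + A)) = 1 := by
  have hs := sqrtTwo_mul_self
  have h : (z • (1 - e) + A) * (-z • (1 - e) + A) = (2 : ℂ) • 1 := by
    have h1 : (1 - e) * (1 - e) = 1 + (√2 - 1 : ℂ) • e := by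
      rw [sub_mul, mul_sub, mul_sub, he, one_mul, mul_one, one_mul]
      module
    have h2 : (1 - e) * A = A := by rw [sub_mul, heA, one_mul, sub_zero]
    have h3 : A * (1 - e) = A := by rw [mul_sub, hAe, mul_one, sub_zero]
    rw [add_mul, mul_add, mul_add, smul_mul_smul_comm, smul_mul_assoc, mul_smul_comm, h1, h2, h3,
      hA, mul_neg, hz, neg_neg, one_smul]
    module
  rw [smul_mul_smul_comm, h, smul_smul]
  have h4 : (√2 / 2 * (√2 / 2) * 2 : ℂ) = 1 := by linear_combination hs / 2
  rw [h4, one_smul]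

theorem elementR_eq (lam : ℂ) : elementR lam =
    (√2 / 2 : ℂ) • (Complex.I • (1 - cupcap shuriken true) + elementA lam) := by
  have hs := sqrtTwo_mul_self
  have h : (1 + √2 : ℂ) • jones shuriken true = cupcap shuriken true := by
    rw [jones_eq, smul_smul, show (1 + √2 : ℂ) * (√2 - 1) = 1 by linear_combination hs, one_smul]
  rw [elementR, h]
  module

/-- The inverse of `R(lam)`. -/
noncomputable def elementRInv (lam : ℂ) : Matrix (Path shuriken true 2) (Path shuriken true 2) ℂ :=
  (√2 / 2 : ℂ) • (-Complex.I • (1 - cupcap shuriken true) + elementA lam)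

theorem elementR_mul_inv (lam : ℂ) (hlam : lam * conj lam = 1) :
    elementR lam * elementRInv lam = 1 := by
  rw [elementR_eq]
  exact mul_eq_one_of_sq Complex.I_mul_I (cupcap_mul_self _) (cupcap_mul_elementA lam)
    (elementA_mul_cupcap lam) (elementA_mul_self lam hlam)

theorem elementR_inv (lam : ℂ) (hlam : lam * conj lam = 1) :
    (elementR lam)⁻¹ = elementRInv lam :=
  Matrix.inv_eq_right_inv (elementR_mul_inv lam hlam)

theorem rotate_sub {s t : Bool} (h : t = !s)
    (X Y : Matrix (Path shuriken s 2) (Path shuriken s 2) ℂ) :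
    rotate h (X - Y) = rotate h X - rotate h Y := by
  rw [sub_eq_add_neg, ← neg_one_smul ℂ, rotate_add, rotate_smul, neg_one_smul, sub_eq_add_neg]

theorem rotate_elementRInv (lam : ℂ) : rotate (t := false) rfl (elementRInv lam) =
    (√2 / 2 : ℂ) • ofCoeff shuriken false (coeffY lam) := by
  rw [elementRInv, rotate_smul, rotate_add, rotate_smul, rotate_sub, rotate_one, rotate_cupcap,
    rotate_elementA, ofCoeff_coeffY]
  module

theorem rotate_elementR (lam : ℂ) : rotate (t := false) rfl (elementR lam) =
    (√2 / 2 : ℂ) • (-Complex.I • (1 - cupcap shuriken false) +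
      ofCoeff shuriken false (coeffB lam)) := by
  rw [elementR_eq, rotate_smul, rotate_add, rotate_smul, rotate_sub, rotate_one, rotate_cupcap,
    rotate_elementA]
  module

theorem rotateTwice_elementR (lam : ℂ) : rotateTwice (elementR lam) = elementR lam := by
  have hA := rotateTwice_elementA lam
  rw [rotateTwice] at hA ⊢
  simp only [elementR_eq, rotate_smul, rotate_add, rotate_sub, rotate_one, rotate_cupcap, hA]

theorem exists_elementR_eq_ofCoeff (lam : ℂ) : ∃ c, elementR lam = ofCoeff shuriken true c :=
  ⟨_, by rw [elementR_eq, ← ofCoeff_coeffX, ofCoeff_smul]⟩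

theorem exists_elementRInv_eq_ofCoeff (lam : ℂ) :
    ∃ c, elementRInv lam = ofCoeff shuriken true c :=
  ⟨_, by rw [elementRInv, sub_eq_add_neg, ← neg_one_smul ℂ (cupcap _ _), one_eq_ofCoeff,
    cupcap_eq_ofCoeff, elementA_eq, ofCoeff_smul, ofCoeff_add, ofCoeff_smul, ofCoeff_add,
    ofCoeff_smul]⟩

theorem horizontalMul_elementR (lam : ℂ) (hlam : lam * conj lam = 1) :
    horizontalMul (elementR lam) (rotateTwice (elementRInv lam)) = cupcap shuriken true := by
  obtain ⟨c, hc⟩ := exists_elementR_eq_ofCoeff lam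
  obtain ⟨d, hd⟩ := exists_elementRInv_eq_ofCoeff lam
  have h := horizontalMul_rotateTwice (Γ := shuriken) c d
  rw [← hc, ← hd, rotateTwice_elementR, rotate_elementR, rotate_elementRInv, ofCoeff_coeffY,
    mul_eq_one_of_sq Complex.I_mul_I (cupcap_mul_self _) (cupcap_mul_ofCoeff_coeffB lam)
    (ofCoeff_coeffB_mul_cupcap lam) (ofCoeff_coeffB_mul_self lam hlam), rotate_one] at h
  exact h

theorem capRight_elementR (lam : ℂ) :
    capRight (t := false) rfl (elementR lam) = Complex.I • 1 := by
  have hs := sqrtTwo_mul_self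
  have hE : capRight (t := false) rfl (cupcap shuriken true) = 1 := capRight_cupcap rfl
  rw [elementR_eq, capRight_smul, capRight_add, capRight_elementA, sub_eq_add_neg,
    ← neg_one_smul ℂ (cupcap _ _), capRight_smul, capRight_add, capRight_smul, capRight_one, hE,
    modulus_eq]
  match_scalars
  linear_combination Complex.I * hs / 2

theorem capRight_rotate_elementR (lam : ℂ) :
    capRight (t := true) rfl (rotate (t := false) rfl (elementR lam)) = Complex.I⁻¹ • 1 := by
  have hs := sqrtTwo_mul_self
  have hE : capRight (t := true) rfl (cupcap shuriken false) = 1 := capRight_cupcap rfl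
  rw [rotate_elementR, capRight_smul, capRight_add, capRight_ofCoeff_coeffB, sub_eq_add_neg,
    ← neg_one_smul ℂ (cupcap _ _), capRight_smul, capRight_add, capRight_smul, capRight_one, hE,
    modulus_eq, Complex.inv_I]
  match_scalars
  linear_combination -Complex.I * hs / 2

theorem uncappable_elementA (lam : ℂ) : Uncappable (elementA lam) where
  top := by
    have h : cap shuriken true * (cupcap shuriken true * elementA lam) = 0 := by
      rw [cupcap_mul_elementA, Matrix.mul_zero]
    rw [cupcap, Matrix.mul_assoc, ← Matrix.mul_assoc, cap_mul_cup, Matrix.smul_mul,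
      Matrix.one_mul] at h
    exact (smul_eq_zero.1 h).resolve_left modulus_ne_zero
  bottom := by
    have h : elementA lam * cupcap shuriken true * cup shuriken true = 0 := by
      rw [elementA_mul_cupcap, Matrix.zero_mul]
    rw [cupcap, Matrix.mul_assoc, Matrix.mul_assoc, cap_mul_cup, Matrix.mul_smul, Matrix.mul_smul,
      Matrix.mul_one] at h
    exact (smul_eq_zero.1 h).resolve_left modulus_ne_zero
  right := capRight_elementA lam
  left := capLeft_elementA lam

theorem braid_elementR (lam : ℂ) (hlam : lam * conj lam = 1) :
    addRight (elementR lam) * addLeft (t := true) rfl (rotate (t := false) rfl (elementRInv lam)) *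
      addRight (elementR lam) =
    addLeft (t := true) rfl (rotate (t := false) rfl (elementRInv lam)) * addRight (elementR lam) *
      addLeft (t := true) rfl (rotate (t := false) rfl (elementRInv lam)) := by
  rw [rotate_elementRInv, elementR_eq, ← ofCoeff_coeffX]
  simp only [addRight_smul, addLeft_smul, Matrix.smul_mul, Matrix.mul_smul,
    braid_coeffX_coeffY lam hlam]

theorem cupcap_mem_temperleyLieb : cupcap shuriken true ∈ temperleyLieb shuriken :=
  Submodule.subset_span (by simp)

theorem one_mem_temperleyLieb : 1 ∈ temperleyLieb shuriken :=
  Submodule.subset_span (by simp)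

theorem elementR_sq (lam : ℂ) (hlam : lam * conj lam = 1) : elementR lam * elementR lam =
    (1 - (√2 : ℂ) • cupcap shuriken true) + (Complex.I * √2) • elementR lam := by
  have h : elementR lam =
      elementRInv lam + (Complex.I * √2) • (1 - cupcap shuriken true) := by
    rw [elementR_eq, elementRInv]
    module
  have hE : elementR lam * cupcap shuriken true = -Complex.I • cupcap shuriken true := by
    have hs := sqrtTwo_mul_self
    rw [elementR_eq, Matrix.smul_mul, Matrix.add_mul, elementA_mul_cupcap, Matrix.smul_mul,
      Matrix.sub_mul, cupcap_mul_self, Matrix.one_mul]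
    match_scalars
    linear_combination -Complex.I * hs / 2
  have hi := Complex.I_mul_I
  nth_rw 2 [h]
  rw [Matrix.mul_add, elementR_mul_inv lam hlam, Matrix.mul_smul, Matrix.mul_sub,
    Matrix.mul_one, hE]
  match_scalars
  · rfl
  · ring
  · linear_combination √2 * hi

/-- The path `0, 7, v` on the graph, for a neighbour `v` of `7`. -/
def pathZero (v : Fin 8) (hv : shuriken.graph.Adj 7 v) : Path shuriken true 2 :=
  ⟨![0, 7, v], by simp [shuriken_even], by
    intro i
    fin_cases i
    · simp [shuriken_adj]
    · exact hv⟩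

theorem disjoint_temperleyLieb_elementR (lam : ℂ) :
    Disjoint (temperleyLieb shuriken) (Submodule.span ℂ {elementR lam}) := by
  rw [Submodule.disjoint_def]
  intro X hX hX'
  obtain ⟨k, rfl⟩ := Submodule.mem_span_singleton.1 hX'
  obtain ⟨a, b, hab⟩ := Submodule.mem_span_pair.1 hX
  -- elements of the Temperley-Lieb space have equal coefficients at the loops `0747` and `0767`
  let p := pathZero 4 (by simp [shuriken_adj])
  let q := pathZero 6 (by simp [shuriken_adj])
  have hp := congrFun (congrFun hab p) p
  have hq := congrFun (congrFun hab q) q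
  rw [elementR_eq, ← ofCoeff_coeffX, cupcap_eq_ofCoeff] at hp hq
  have hp1 : ofCoeff shuriken true (coeffX lam) p p = Complex.I - 1 :=
    (if_pos ⟨rfl, rfl⟩).trans (by
      change coeffX lam 0 7 4 7 = _
      simp only [coeffX_values])
  have hq1 : ofCoeff shuriken true (coeffX lam) q q = Complex.I + 1 :=
    (if_pos ⟨rfl, rfl⟩).trans (by
      change coeffX lam 0 7 6 7 = _
      simp only [coeffX_values])
  have hpE : ofCoeff shuriken true (fun w x y z => if w = y then
    (√(shuriken.weight x / shuriken.weight w) * √(shuriken.weight z / shuriken.weight w) : ℂ)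
      else 0) p p = 0 := (if_pos ⟨rfl, rfl⟩).trans (if_neg (by simp [p, pathZero]))
  have hqE : ofCoeff shuriken true (fun w x y z => if w = y then
    (√(shuriken.weight x / shuriken.weight w) * √(shuriken.weight z / shuriken.weight w) : ℂ)
      else 0) q q = 0 := (if_pos ⟨rfl, rfl⟩).trans (if_neg (by simp [q, pathZero]))
  simp only [Matrix.add_apply, Matrix.smul_apply, Matrix.one_apply_eq, smul_eq_mul, hpE, hqE, hp1,
    hq1] at hp hq
  have hk : k * √2 = 0 := by linear_combination hp - hq
  have h2 : (√2 : ℂ) ≠ 0 := by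
    intro h
    simpa [h] using sqrtTwo_mul_self
  rw [(mul_eq_zero.1 hk).resolve_right h2, zero_smul]

theorem isQuadraticBraidingWith_elementR (lam : ℂ) (hlam : lam * conj lam = 1) :
    IsQuadraticBraidingWith 1 Complex.I (elementR lam) where
  mem_box := by
    obtain ⟨c, hc⟩ := exists_elementR_eq_ofCoeff lam
    rw [hc]
    exact ofCoeff_mem_box c
  ne_zero := Complex.I_ne_zero
  inv_mul := by
    rw [elementR_inv lam hlam]
    exact mul_eq_one_comm.1 (elementR_mul_inv lam hlam)
  mul_inv := by
    rw [elementR_inv lam hlam]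
    exact elementR_mul_inv lam hlam
  horizontal_inv := by
    rw [elementR_inv lam hlam]
    exact horizontalMul_elementR lam hlam
  cap_left_star := capRight_elementR lam
  cap_top_star := by
    rw [one_mul]
    exact capRight_rotate_elementR lam
  rotate_sub_mem := by
    rw [one_pow, one_smul, rotateTwice_elementR, sub_self]
    exact Submodule.zero_mem _
  braid := by
    rw [one_pow, one_smul, one_smul, elementR_inv lam hlam]
    exact braid_elementR lam hlam
  quadratic := by
    rw [elementR_sq lam hlam]
    exact Submodule.add_mem_sup
      (Submodule.sub_mem _ one_mem_temperleyLieb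
        (Submodule.smul_mem _ _ cupcap_mem_temperleyLieb))
      (Submodule.smul_mem _ _ (Submodule.mem_span_singleton_self _))
  disjoint := disjoint_temperleyLieb_elementR lam

theorem eq_I_of_isQuadraticBraidingWith (lam : ℂ) {a : ℂ}
    (h : IsQuadraticBraidingWith 1 a (elementR lam)) : a = Complex.I := by
  have h1 := h.cap_left_star.symm.trans (capRight_elementR lam)
  let p : Path shuriken true 1 := ⟨![0, 7], by simp [shuriken_even], by
    intro i
    fin_cases i
    simp [shuriken_adj]⟩
  simpa using congrFun (congrFun h1 p) p

theorem elementR_sub_inv (lam : ℂ) (hlam : lam * conj lam = 1) :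
    elementR lam - (elementR lam)⁻¹ = (Complex.I * √2) • 1 -
      (Complex.I * (2 + √2)) • jones shuriken true := by
  have hs := sqrtTwo_mul_self
  rw [elementR_inv lam hlam, elementR_eq, elementRInv, jones_eq]
  match_scalars
  · ring
  · linear_combination Complex.I * hs
  · ring

end GraphPlanar
open GraphPlanar in
theorem mainTheorem12 (lam : ℂ) (hlam : ‖lam‖ = 1) :
    -- the defining properties of the family `A(lam)`
    (elementA lam ∈ box shuriken true 2 ∧
      (elementA lam)ᴴ = elementA lam ∧
      rotateTwice (elementA lam) = elementA lam ∧
      Uncappable (elementA lam) ∧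
      elementA lam * elementA lam = jonesWenzl shuriken true ∧
      rotate (t := false) rfl (elementA lam) * rotate (t := false) rfl (elementA lam) =
        jonesWenzl shuriken false) ∧
    -- `R(lam)` is a quadratic `(+1)`-braiding, and its constant is `a = i`
    IsQuadraticBraiding 1 (elementR lam) ∧
    (∀ a : ℂ, IsQuadraticBraidingWith 1 a (elementR lam) ↔ a = Complex.I) ∧
    rotateTwice (elementR lam) = elementR lam ∧
    elementR lam - (elementR lam)⁻¹ =
      (Complex.I * Real.sqrt 2) • 1 -
        (Complex.I * (2 + Real.sqrt 2)) • jones shuriken true := by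
  have hl : lam * (starRingEnd ℂ) lam = 1 := by
    rw [Complex.mul_conj, Complex.normSq_eq_norm_sq, hlam]
    simp
  have hR := isQuadraticBraidingWith_elementR lam hl
  refine ⟨⟨ofCoeff_mem_box _, elementA_conjTranspose lam, rotateTwice_elementA lam,
    uncappable_elementA lam, ?_, ?_⟩, ⟨_, hR⟩,
    fun a => ⟨eq_I_of_isQuadraticBraidingWith lam, fun h => h ▸ hR⟩,
    rotateTwice_elementR lam, elementR_sub_inv lam hl⟩
  · rw [jonesWenzl_eq, elementA_mul_self lam hl]
  · rw [jonesWenzl_eq, rotate_elementA, ofCoeff_coeffB_mul_self lam hl]
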